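/- **Setting.** An automaton is $A=(Y,\Sigma,\alpha,y_0,Y_m)$ with finite state set $Y$, finite event set $\Sigma$, partial transition function $\alpha:Y\times\Sigma\to Y$ (extended to strings), initial state $y_0\in Y$ and marked states $Y_m\subseteq Y$; $\alpha(y,s)!$ means "is defined". $L(A)=\{s:\alpha(y_0,s)!\}$, $L_m(A)=\{s:\alpha(y_0,s)\in Y_m\}$. Let $G=(Q,\Sigma,\delta,q_0,Q_m)$ (plant) and $S=(X,\Sigma,\xi,x_0,X_m)$ (supervisor) be automata and $\Sigma_c\subseteq\Sigma$ the controllable events of one agent. For $x\in X$ put $E(x)=\{\sigma:\xi(x,\sigma)!\}$, $D(x)=\{\sigma\in\Sigma_{c}:\neg\xi(x,\sigma)!,\ \exists s\,(\xi(x_0,s)=x\wedge\delta(q_0,s\sigma)!)\}$, $M(x)=1$ iff $x\in X_m$, and $T(x)=1$ iff $\exists s\,(\xi(x_0,s)=x\wedge\delta(q_0,s)\in Q_m)$ (else $0$). Let $(x,x')\in\mathcal R$ iff $E(x)\cap D(x')=\emptyset=E(x')\cap D(x)$ and $T(x)=T(x')\Rightarrow M(x)=M(x')$. A *control congruence* w.r.t.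 $G,S,\Sigma_c$ is a partition $\mathcal C$ of $X$ into (nonempty) cells such that any two states of a cell are in $\mathcal R$ and, for every cell $\pi$ and event $\sigma$, all existing $\xi(x,\sigma)$ with $x\in\pi$ lie in one common cell. $[x]$ is the cell of $x$. The *local supervisor* of $\mathcal C$ is the automaton with states $\mathcal C$, events $\Sigma$, initial state $[x_0]$, marked states $\{[x]:x\in X_m\}$, and a transition $\pi_1\xrightarrow{\sigma}\pi_2$ iff $\xi(x,\sigma)\in\pi_2$ for some $x\in\pi_1$. **Input.** A base system: $G$, $S$ over the same events, pairwise disjoint sets $\Sigma_{c,k}\subseteq\Sigma$ and a control congruence $\mathcal C_k$ w.r.t. $G,S,\Sigma_{c,k}$ for each agent $1\le k\le n$. A variant system: $G'$, $S'=(X',\Sigma',\xi',x_0',X_m')$ over the same events and pairwise disjoint $\Sigma'_{c,k}\subseteq\Sigma'$ for $1\le k\le n'$, $n'\ge1$, where $S'$ is a supervisor for $G'$: if $s\in L(S')$, $s\sigma\in L(G')$ and $\sigma\notin\bigcup_k\Sigma'_{c,k}$, then $s\sigma\in L(S')$; and every state of $X'_m$ is reached in $S'$ by some string of $L_m(G')$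 (as is the case if $S'$ is accessible and $L_m(S')\subseteq L_m(G')$). A map $\mathcal M:\{1,\dots,n'\}\to\{0,\dots,n\}$. The states of $X'$ are numbered $0,\dots,|X'|-1$ in an arbitrary way. **TSL.** For each $k=1,\dots,n'$ (with $\mathcal R'$ the relation for $G',S',\Sigma'_{c,k}$, and cells taken in the current cover): 1. If $\mathcal M(k)=0$, let $\mathcal C=\{\{x\}:x\in X'\}$. Otherwise run `isolate`: start with $\mathcal C=\{\pi\cap X':\pi\in\mathcal C_{\mathcal M(k)}\}\setminus\{\emptyset\}\cup\{\{x\}:x\in X'\setminus X\}$ and repeat rounds until a round changes nothing; a round runs through all $x\in X\cap X'$, and if some $x'\in[x]$ has $(x,x')\notin\mathcal R'$ or $[\xi'(x,\sigma)]\ne[\xi'(x',\sigma)]$ for an event $\sigma$ enabled in both, it replaces the cell $[x]$ by $[x]\setminus\{x\}$ and $\{x\}$. 2. Run `localize` on $\mathcal C$: for $i=0,1,\dots$ with $x_i$ of least number in its cell, and for each $j>i$ with $x_j$ of least number in its cell, set $W=\emptyset$ and call `check_merge`$(x_i,x_j)$; if it returns true, replace $\mathcal C$ by the set of all $[x]\cup\bigcup\{[x']:(x,x')\in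 W\text{ or }(x',x)\in W\}$, $x\in X'$. Here `check_merge`$(a,b)$ runs through all pairs $(p,q)\in N(a)\times N(b)$ for which neither $(p,q)$ nor $(q,p)$ is in $W$, where $N(a)=[a]\cup\bigcup\{[x]:W\text{ contains }(x,a')\text{ or }(a',x)\text{ for some }a'\in[a]\}$ always refers to the current $W$, and returns true when none is left. For such a pair it returns false if $(p,q)\notin\mathcal R'$; otherwise it adds $(p,q)$ to $W$ and, for each event enabled in both, with successors $u,v$: nothing is done if $[u]=[v]$ or $W$ contains $(u,v)$ or $(v,u)$; it returns false if $[u]$ or $[v]$ contains a state numbered less than $i$; else it calls `check_merge`$(u,v)$ and returns false if this call does. 3. Let $\mathcal C'_k$ be the result and $LOC'_k$ its local supervisor. **Cost.** Charged are: one operation for each round of `isolate`, each iteration of a loop of TSL, `isolate` or `localize`, each isolation of a state, each call of `check_merge`, each insertion into $W$, and each common event examined for a processed pair; $1+|\Sigma'|$ for each test of a pair of states in `isolate`; $1+|\Sigma'|$ for each consistency test in `check_merge` and $|\Sigma'|$ for computing the common events of a pair; $|X'|$ for setting up the initial cover; $|X'|^2$ for each merge; $|X'|(1+|\Sigma'|)$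 for building a local supervisor. Access to $E',D',M',T'$, to cells, to their least numbers and to $W$, and the selection of the next pair that is not in $W$, are free. **Theorem.** Whatever the order in which the loops over sets are run through, TSL terminates; each $\mathcal C'_k$ is a control congruence w.r.t. $G',S',\Sigma'_{c,k}$; and the local supervisors $LOC'_1,\dots,LOC'_{n'}$ are control equivalent to $S'$ with respect to $G'$: $$L(G')\cap\bigcap_{k=1}^{n'}L(LOC'_k)=L(S')\cap L(G'),\qquad L_m(G')\cap\bigcap_{k=1}^{n'}L_m(LOC'_k)=L_m(S')\cap L_m(G').$$ If $\Sigma'\neq\emptyset$, the cost is $O(n'\cdot|\Sigma'|\cdot|X'|^4)$, with an absolute implied constant. -/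

import Mathlib

open scoped Classical

noncomputable section

namespace SupLoc

/-! ### Automata, languages and control consistency -/

/-- The data of an automaton with a partial transition function
(`trans x σ = none` means that the transition is undefined). -/
structure Automaton (St Ev : Type*) where
  states : Finset St
  events : Finset Ev
  trans : St → Ev → Option St
  init : St
  marked : Finset St

namespace Automaton

variable {St Ev : Type*}

/-- The initial and the marked states are states, and transitions lead from states to states along
events of the automaton. -/
structure Valid (A : Automaton St Ev) : Prop where
  init_mem : A.init ∈ A.states
  marked_subset : A.marked ⊆ A.states
  trans_mem : ∀ x σ y, A.trans x σ = some y → x ∈ A.states ∧ σ ∈ A.events ∧ y ∈ A.states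

/-- The state reached from the initial state by a string, if there is one. -/
def run (A : Automaton St Ev) (s : List Ev) : Option St :=
  s.foldlM A.trans A.init

/-- The language `L(A)`. -/
def lang (A : Automaton St Ev) : Set (List Ev) :=
  {s | ∃ x, A.run s = some x}

/-- The marked language `L_m(A)`. -/
def markedLang (A : Automaton St Ev) : Set (List Ev) :=
  {s | ∃ x ∈ A.marked, A.run s = some x}

/-- `E(x)`: the events enabled in `x`. -/
def enabled (A : Automaton St Ev) (x : St) : Finset Ev :=
  A.events.filter fun σ => ∃ y, A.trans x σ = some y

end Automaton

/-- A plant, a monolithic supervisor, and for each of `n` agents its set of controllable events. -/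
structure ControlledSystem (Q X Ev : Type*) (n : ℕ) where
  plant : Automaton Q Ev
  sup : Automaton X Ev
  ctrl : Fin n → Finset Ev

/-- Plant and supervisor are automata over the same events, and the sets of controllable events
of the agents are pairwise disjoint subsets of these. -/
structure ControlledSystem.Valid {Q X Ev : Type*} {n : ℕ} (P : ControlledSystem Q X Ev n) :
    Prop where
  plant_valid : P.plant.Valid
  sup_valid : P.sup.Valid
  events_eq : P.sup.events = P.plant.events
  ctrl_subset : ∀ k, P.ctrl k ⊆ P.plant.events
  ctrl_disjoint : Pairwise fun k l => Disjoint (P.ctrl k) (P.ctrl l)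

section Consistency

variable {Q X Ev : Type*} (G : Automaton Q Ev) (S : Automaton X Ev) (Sc : Finset Ev)

/-- `D(x)`: the events in `Sc` that the supervisor disables in `x` although the plant can execute
them after some string leading to `x`. -/
def disabled (x : X) : Finset Ev :=
  Sc.filter fun σ => S.trans x σ = none ∧ ∃ s, S.run s = some x ∧ s ++ [σ] ∈ G.lang

/-- `T(x) = 1`: some string leading to `x` is marked by the plant. -/
def PlantMarked (x : X) : Prop :=
  ∃ s, S.run s = some x ∧ s ∈ G.markedLang

/-- The control consistency relation of an agent with controllable events `Sc`. -/
def Consistent (x x' : X) : Prop :=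
  Disjoint (S.enabled x) (disabled G S Sc x') ∧
  Disjoint (S.enabled x') (disabled G S Sc x) ∧
  ((PlantMarked G S x ↔ PlantMarked G S x') → (x ∈ S.marked ↔ x' ∈ S.marked))

/-- Control covers. -/
structure IsControlCover (C : Finset (Finset X)) : Prop where
  cell_subset : ∀ π ∈ C, π ⊆ S.states
  covers : ∀ x ∈ S.states, ∃ π ∈ C, x ∈ π
  consistent : ∀ π ∈ C, ∀ x ∈ π, ∀ x' ∈ π, Consistent G S Sc x x'
  successor : ∀ π ∈ C, ∀ σ ∈ S.events, (∃ x ∈ π, ∃ y, S.trans x σ = some y) →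
    ∃ ρ ∈ C, ∀ x' ∈ π, ∀ y, S.trans x' σ = some y → y ∈ ρ

/-- A control congruence is a control cover that is a partition of the state set. -/
structure IsControlCongruence (C : Finset (Finset X)) : Prop extends
    IsControlCover G S Sc C where
  nonempty : ∀ π ∈ C, π.Nonempty
  disjoint : ∀ π ∈ C, ∀ ρ ∈ C, π ≠ ρ → Disjoint π ρ

end Consistency

/-- The supervisor of `P` is a supervisor for the plant of `P`: it never disables an uncontrollable
event, and each of its marked states is reached by some string that the plant marks. The latter
holds if the supervisor is accessible and `L_m(S) ⊆ L_m(G)`. -/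
structure ControlledSystem.IsSupervised {Q X Ev : Type*} {n : ℕ} (P : ControlledSystem Q X Ev n) :
    Prop where
  controllable : ∀ s σ, s ∈ P.sup.lang → s ++ [σ] ∈ P.plant.lang → (∀ k, σ ∉ P.ctrl k) →
    s ++ [σ] ∈ P.sup.lang
  marking : ∀ x ∈ P.sup.marked, PlantMarked P.plant P.sup x

/-! ### Cells and local supervisors -/

section Cells

variable {X Ev : Type*}

/-- `[x]`: the states that lie in a common cell with `x`. -/
def cell (C : Finset (Finset X)) (x : X) : Finset X :=
  (C.filter fun π => x ∈ π).biUnion id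

/-- The partition into singletons. -/
def singletonCover (S : Automaton X Ev) : Finset (Finset X) :=
  S.states.image fun x => {x}

/-- The local supervisor of a control congruence `C`: from the cell `π`, the event `σ` leads to
the cell `ρ` iff `ξ(x, σ) ∈ ρ` for some `x ∈ π`. -/
def localSupervisor (S : Automaton X Ev) (C : Finset (Finset X)) : Automaton (Finset X) Ev where
  states := C
  events := S.events
  trans π σ :=
    if h : π ∈ C ∧ ∃ ρ ∈ C, ∃ x ∈ π, ∃ y ∈ ρ, S.trans x σ = some y then some h.2.choose else none
  init := cell C S.init
  marked := S.marked.image (cell C)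

/-- For a control congruence the transition function above is the relation that defines it. -/
theorem localSupervisor_trans {Q : Type*} {G : Automaton Q Ev} {S : Automaton X Ev}
    {Sc : Finset Ev} {C : Finset (Finset X)} (hS : S.Valid) (hC : IsControlCongruence G S Sc C)
    (π ρ : Finset X) (σ : Ev) :
    (localSupervisor S C).trans π σ = some ρ ↔
      π ∈ C ∧ ρ ∈ C ∧ ∃ x ∈ π, ∃ y ∈ ρ, S.trans x σ = some y := by
  have key : ∀ ρ₁ ∈ C, ∀ ρ₂ ∈ C, π ∈ C → (∃ x ∈ π, ∃ y ∈ ρ₁, S.trans x σ = some y) →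
      (∃ x ∈ π, ∃ y ∈ ρ₂, S.trans x σ = some y) → ρ₁ = ρ₂ := by
    rintro ρ₁ h₁ ρ₂ h₂ hπ ⟨x, hx, y, hy, hxy⟩ ⟨x', hx', y', hy', hxy'⟩
    obtain ⟨τ, hτ, h⟩ := hC.successor π hπ σ (hS.trans_mem _ _ _ hxy).2.1 ⟨x, hx, y, hxy⟩
    have e₁ : ρ₁ = τ := by
      by_contra hne
      exact Finset.disjoint_left.1 (hC.disjoint _ h₁ _ hτ hne) hy (h x hx y hxy)
    have e₂ : ρ₂ = τ := by
      by_contra hne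
      exact Finset.disjoint_left.1 (hC.disjoint _ h₂ _ hτ hne) hy' (h x' hx' y' hxy')
    rw [e₁, e₂]
  simp only [localSupervisor]
  split_ifs with h
  · have hc := h.2.choose_spec
    constructor
    · intro e
      have e' := Option.some.inj e
      rw [← e']
      exact ⟨h.1, hc.1, hc.2⟩
    · rintro ⟨hπ, hρ, hx⟩
      exact congrArg some (key _ hc.1 _ hρ hπ hc.2 hx)
  · constructor
    · intro e
      cases e
    · rintro ⟨hπ, hρ, hx⟩
      exact absurd ⟨hπ, ρ, hρ, hx⟩ h

end Cells

/-- A family of local supervisors is control equivalent to `S` with respect to `G`. -/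
def ControlEquivalent {Q X Y Ev : Type*} {n : ℕ} (G : Automaton Q Ev) (S : Automaton X Ev)
    (loc : Fin n → Automaton Y Ev) : Prop :=
  G.lang ∩ (⋂ k, (loc k).lang) = S.lang ∩ G.lang ∧
  G.markedLang ∩ (⋂ k, (loc k).markedLang) = S.markedLang ∩ G.markedLang

/-! ### Algorithms

The algorithms are programs that may fail to halt and that carry a counter of the operations
executed so far. The recursion of `checkMerge` and the while-loop of `isolate` are not known to
end beforehand: they get a bound on the recursion depth, resp. on the number of rounds (`fuel`),
and give no result when it is exceeded. A program halts with a result if it gives this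
result for all sufficiently large values of `fuel`. -/

/-- Computations that may give no result and that count operations. -/
abbrev Counted (α : Type) := StateT ℕ Option α

/-- Charge `k` operations. -/
def charge (k : ℕ) : Counted Unit := modify (· + k)

/-- The program halts with this result after this number of operations. -/
def HaltsWith {α : Type} (prog : ℕ → Counted α) (result : α) (operations : ℕ) : Prop :=
  ∃ f₀, ∀ fuel, f₀ ≤ fuel → (prog fuel).run 0 = some (result, operations)

/-- The order in which a loop `for all` runs through a set of states, of events or of pairs of
states. -/
structure LoopOrder (X Ev : Type) where
  states : Finset X → List X
  states_nodup : ∀ s, (states s).Nodup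
  mem_states : ∀ s x, x ∈ states s ↔ x ∈ s
  events : Finset Ev → List Ev
  events_nodup : ∀ s, (events s).Nodup
  mem_events : ∀ s σ, σ ∈ events s ↔ σ ∈ s
  pair : Finset (X × X) → X × X
  pair_mem : ∀ s, s.Nonempty → pair s ∈ s

section Algorithms

variable {Q X Ev : Type}

/-! #### `isolate` -/

/-- Remove the states that are no longer there (a cell that becomes empty disappears) and add
the new states as singletons. -/
def isolateInit (C : Finset (Finset X)) (old new : Finset X) : Finset (Finset X) :=
  ((C.image fun π => π \ (old \ new)).erase ∅) ∪ (new \ old).image fun x => {x}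

/-- The state `x` is in conflict with a state of its cell. -/
def Conflict (G : Automaton Q Ev) (S : Automaton X Ev) (Sc : Finset Ev) (C : Finset (Finset X))
    (x : X) : Prop :=
  ∃ x' ∈ cell C x, ¬ Consistent G S Sc x x' ∨
    ∃ σ y y', S.trans x σ = some y ∧ S.trans x' σ = some y' ∧ cell C y ≠ cell C y'

/-- One round of the while-loop: the new cover, and whether some state was isolated. -/
def isolateRound (ord : LoopOrder X Ev) (G : Automaton Q Ev) (S : Automaton X Ev) (Sc : Finset Ev)
    (old : Finset X) (C : Finset (Finset X)) : Counted (Finset (Finset X) × Bool) :=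
  (ord.states (S.states ∩ old)).foldlM (fun (acc : Finset (Finset X) × Bool) x => do
    -- one consistency test and one comparison of successors per event, for each state of the cell
    charge (1 + (cell acc.1 x).card * (1 + S.events.card))
    if Conflict G S Sc acc.1 x then do
      charge 1
      pure ((acc.1 \ {cell acc.1 x}) ∪ {cell acc.1 x \ {x}} ∪ {{x}}, true)
    else
      pure acc) (C, false)

/-- The while-loop. -/
def isolateLoop (ord : LoopOrder X Ev) (G : Automaton Q Ev) (S : Automaton X Ev) (Sc : Finset Ev)
    (old : Finset X) : ℕ → Finset (Finset X) → Counted (Finset (Finset X))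
  | 0, _ => failure
  | fuel + 1, C => do
    charge 1
    let r ← isolateRound ord G S Sc old C
    if r.2 then isolateLoop ord G S Sc old fuel r.1 else pure r.1

/-- `isolate`, where `C` is a cover of the set `old` of states of the base supervisor. -/
def isolate (ord : LoopOrder X Ev) (G : Automaton Q Ev) (S : Automaton X Ev) (Sc : Finset Ev)
    (old : Finset X) (fuel : ℕ) (C : Finset (Finset X)) : Counted (Finset (Finset X)) := do
  charge S.states.card
  isolateLoop ord G S Sc old fuel (isolateInit C old S.states)

/-! #### `check_merge` -/

/-- `(x, y)` or `(y, x)` is in the waiting list `W`. -/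
def Listed (W : Finset (X × X)) (x y : X) : Prop := (x, y) ∈ W ∨ (y, x) ∈ W

/-- `[a]` together with the cells `[x]` of all `x` that `W` pairs with a state of `[a]`. -/
def near (S : Automaton X Ev) (C : Finset (Finset X)) (W : Finset (X × X)) (a : X) : Finset X :=
  cell C a ∪ (S.states.filter fun x => ∃ a' ∈ cell C a, Listed W x a').biUnion (cell C)

/-- The pairs over which the double loop of `check_merge` for `a`, `b` still has to run: those
that would be skipped, being in `W` already, are left out. -/
def pending (S : Automaton X Ev) (C : Finset (Finset X)) (W : Finset (X × X)) (a b : X) :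
    Finset (X × X) :=
  (near S C W a ×ˢ near S C W b).filter fun p => ¬ Listed W p.1 p.2

/-- `min {m | x_m ∈ [x]} < i`. -/
def HasSmaller {N : ℕ} (num : Fin N → X) (C : Finset (Finset X)) (x : X) (i : Fin N) : Prop :=
  ∃ m, m < i ∧ num m ∈ cell C x

/-- The loop of `check_merge` over the events that `p` and `q` both enable; `call` is the
recursive call. -/
def eventLoop {N : ℕ} (S : Automaton X Ev) (num : Fin N → X) (C : Finset (Finset X)) (i : Fin N)
    (call : X → X → Finset (X × X) → Counted (Bool × Finset (X × X))) (p q : X) :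
    List Ev → Finset (X × X) → Counted (Bool × Finset (X × X))
  | [], W => pure (true, W)
  | σ :: l, W =>
    match S.trans p σ, S.trans q σ with
    | some u, some v => do
      charge 1
      if cell C u = cell C v ∨ Listed W u v then
        eventLoop S num C i call p q l W
      else if HasSmaller num C u i ∨ HasSmaller num C v i then
        pure (false, W)
      else do
        charge 1
        let r ← call u v W
        if r.1 then eventLoop S num C i call p q l r.2 else pure (false, r.2)
    | _, _ => eventLoop S num C i call p q l W

/-- `check_merge`. The index sets of its double loop depend on `W` and grow with it while the loop
runs; the loop ends when no pair is pending. The last line of the `do`-block is the next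
iteration of this loop, with the same `a` and `b`. -/
def checkMerge {N : ℕ} (ord : LoopOrder X Ev) (G : Automaton Q Ev) (S : Automaton X Ev)
    (Sc : Finset Ev) (num : Fin N → X) (C : Finset (Finset X)) (i : Fin N) :
    ℕ → X → X → Finset (X × X) → Counted (Bool × Finset (X × X))
  | 0, _, _, _ => failure
  | fuel + 1, a, b, W =>
    if (pending S C W a b).Nonempty then do
      let pq := ord.pair (pending S C W a b)
      -- the consistency test
      charge (1 + S.events.card)
      if ¬ Consistent G S Sc pq.1 pq.2 then
        pure (false, W)
      else do
        -- the insertion into `W` and the computation of the common events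
        charge (1 + S.events.card)
        let r ← eventLoop S num C i (checkMerge ord G S Sc num C i fuel) pq.1 pq.2
          (ord.events (S.enabled pq.1 ∩ S.enabled pq.2)) (insert pq W)
        if r.1 then checkMerge ord G S Sc num C i fuel a b r.2 else pure (false, r.2)
    else
      pure (true, W)

/-! #### `localize` -/

/-- Merge the cells of listed pairs. -/
def mergeCells (S : Automaton X Ev) (C : Finset (Finset X)) (W : Finset (X × X)) :
    Finset (Finset X) :=
  S.states.image fun x =>
    cell C x ∪ (S.states.filter fun x' => Listed W x x').biUnion (cell C)

/-- `localize`, for states numbered by `num`. -/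
def localize {N : ℕ} (ord : LoopOrder X Ev) (G : Automaton Q Ev) (S : Automaton X Ev)
    (Sc : Finset Ev) (num : Fin N → X) (fuel : ℕ) (Cinit : Finset (Finset X)) :
    Counted (Finset (Finset X)) :=
  (List.finRange N).foldlM (fun C i => do
    charge 1
    if HasSmaller num C (num i) i then pure C
    else
      ((List.finRange N).filter fun j => i < j).foldlM (fun C j => do
        charge 1
        if HasSmaller num C (num j) j then pure C
        else do
          charge 1
          let r ← checkMerge ord G S Sc num C i fuel (num i) (num j) ∅
          if r.1 then do
            charge (S.states.card ^ 2)
            pure (mergeCells S C r.2)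
          else
            pure C) C) Cinit

/-! #### `TSL` -/

/-- `for k = 1 to n do`, collecting the results. -/
def forEach {α : Type} : (n : ℕ) → (Fin n → Counted α) → Counted (Fin n → α)
  | 0, _ => pure Fin.elim0
  | n + 1, body => do
    let a ← body 0
    let rest ← forEach n fun k => body k.succ
    pure (Fin.cons a rest)

/-- The TSL procedure for the base covers `C` of the set `old` of states of the base supervisor,
the variant system `V`, and the mapping `M` of variant agents to base agents (`none` stands for
`0`). It returns the local supervisor and the cover of each variant agent. -/
def tsl {n n' N : ℕ} (ord : LoopOrder X Ev) (num : Fin N → X) (old : Finset X)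
    (C : Fin n → Finset (Finset X)) (V : ControlledSystem Q X Ev n')
    (M : Fin n' → Option (Fin n)) (fuel : ℕ) :
    Counted (Fin n' → Automaton (Finset X) Ev × Finset (Finset X)) :=
  forEach n' fun k => do
    charge 1
    let Cinit ← match M k with
      | some j => isolate ord V.plant V.sup (V.ctrl k) old fuel (C j)
      | none => do
        charge V.sup.states.card
        pure (singletonCover V.sup)
    let Ck ← localize ord V.plant V.sup (V.ctrl k) num fuel Cinit
    -- the construction of the local supervisor
    charge (V.sup.states.card * (1 + V.sup.events.card))
    pure (localSupervisor V.sup Ck, Ck)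

end Algorithms

end SupLoc

end

/-! Both ways of initialising produce a control congruence, every merge in `localize` preserves this
property, and control equivalence follows from it. The loop orders and the tests on least numbers
decide only which mergers succeed, so they play no role in correctness.

The crux is that a successful `check_merge` describes a partition. `Linked C W` is always symmetric
and is an equivalence for empty `W`, but it need not be transitive while calls are open. The
invariant (`trans` in `Progress`) is that it becomes transitive once, for each open call on `(a,
b)`, the neighbourhoods of `a` and `b` are made into one clique (`joinAll`). Opening a call merges
two classes of the completed relation (`join_trans`, moved inwards by `join_comm`); inserting a pair
from N(a) × N(b) leaves that relation unchanged (`join_linked_insert`); on successful closing there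
is nothing left to complete (`join_linked_eq`). When the outermost call succeeds no completion
remains, so `Linked C W` is an equivalence, and its classes inherit consistency and compatible
successors from the pairs in `W` (`mergeCells_isControlCongruence`).

Nested calls and further iterations of `check_merge` come only after an insertion into `W`. There
are at most |X'|² insertions, each paying for at most 4|Σ'| + 2 operations, and `localize` makes at
most |X'|² outer calls; this gives the leading term |Σ'||X'|⁴. In `isolate`, a round that changes
something adds a cell, so there are at most |X'| + 1 rounds.

For the languages, a local supervisor simulates S'. Conversely, by induction on the string, an event
of agent k that LOC'_k and the plant allow cannot be disabled by S', since a state of the same cell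
enables it; events of no agent are covered by controllability. -/

namespace SupLoc

/-! ### Total correctness of counted programs -/

/-- With enough fuel, the program ends with a result `r` after `k` operations such that `P r k`. -/
def Spec {α : Type} (prog : ℕ → Counted α) (P : α → ℕ → Prop) : Prop :=
  ∀ s, ∃ r k, (∃ f₀, ∀ fuel, f₀ ≤ fuel → (prog fuel).run s = some (r, s + k)) ∧ P r k

namespace Spec

variable {α β : Type}

theorem mono {prog : ℕ → Counted α} {P P' : α → ℕ → Prop} (h : Spec prog P)
    (hP : ∀ r k, P r k → P' r k) : Spec prog P' := fun s => by
  obtain ⟨r, k, hr, hp⟩ := h s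
  exact ⟨r, k, hr, hP r k hp⟩

theorem pure {a : α} {P : α → ℕ → Prop} (h : P a 0) :
    Spec (fun _ => (Pure.pure a : Counted α)) P := fun _ => ⟨a, 0, ⟨0, fun _ _ => rfl⟩, h⟩

theorem bind {m : ℕ → Counted α} {g : ℕ → α → Counted β} {P : α → ℕ → Prop}
    {P' : β → ℕ → Prop} (hm : Spec m P)
    (hg : ∀ r k, P r k → Spec (fun f => g f r) fun r' k' => P' r' (k + k')) :
    Spec (fun f => m f >>= g f) P' := fun s => by
  obtain ⟨r, k, ⟨f₁, h₁⟩, hp⟩ := hm s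
  obtain ⟨r', k', ⟨f₂, h₂⟩, hp'⟩ := hg r k hp (s + k)
  refine ⟨r', k + k', ⟨max f₁ f₂, fun f hf => ?_⟩, hp'⟩
  rw [StateT.run_bind, h₁ f (le_trans (le_max_left _ _) hf)]
  simpa [add_assoc] using h₂ f (le_trans (le_max_right _ _) hf)

theorem charge {c : ℕ} {g : ℕ → Counted β} {P : β → ℕ → Prop}
    (hg : Spec g fun r k => P r (c + k)) :
    Spec (fun f => SupLoc.charge c >>= fun _ => g f) P :=
  bind (P := fun _ k => k = c) (fun s => ⟨(), c, ⟨0, fun _ _ => rfl⟩, rfl⟩)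
    (by rintro r k rfl; exact hg)

/-- Only large values of the fuel matter. -/
theorem of_succ {prog : ℕ → Counted α} {P : α → ℕ → Prop} (h : Spec (fun f => prog (f + 1)) P) :
    Spec prog P := fun s => by
  obtain ⟨r, k, ⟨f₀, h₀⟩, hp⟩ := h s
  refine ⟨r, k, ⟨f₀ + 1, fun f hf => ?_⟩, hp⟩
  obtain ⟨f, rfl⟩ : ∃ g, f = g + 1 := ⟨f - 1, by omega⟩
  exact h₀ f (by omega)

theorem foldlM {step : ℕ → β → α → Counted β} {Inv : β → Prop} {c : ℕ} :
    ∀ (l : List α) (b : β), Inv b →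
      (∀ b a, a ∈ l → Inv b → Spec (fun f => step f b a) fun r k => Inv r ∧ k ≤ c) →
      Spec (fun f => l.foldlM (step f) b) fun r k => Inv r ∧ k ≤ l.length * c
  | [], b, hb, _ => by
    simp only [List.foldlM_nil]
    exact pure ⟨hb, by simp⟩
  | a :: l, b, hb, hs => by
    simp only [List.foldlM_cons]
    refine bind (hs b a (by simp) hb) fun r k hr => ?_
    refine (foldlM l r hr.1 fun b a ha => hs b a (by simp [ha])).mono fun r' k' hr' => ?_
    refine ⟨hr'.1, ?_⟩
    have h₁ := hr.2
    have h₂ := hr'.2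
    rw [List.length_cons, add_mul, one_mul]
    omega

theorem forEach {c : ℕ} : ∀ (n : ℕ) {body : ℕ → Fin n → Counted α} {P : Fin n → α → Prop},
    (∀ k, Spec (fun f => body f k) fun r c' => P k r ∧ c' ≤ c) →
    Spec (fun f => SupLoc.forEach n (body f)) fun r c' => (∀ k, P k (r k)) ∧ c' ≤ n * c
  | 0, _, _, _ => pure ⟨fun k => k.elim0, by simp⟩
  | n + 1, body, P, h => by
    refine bind (h 0) fun r k hr => ?_
    refine bind (forEach n fun k => h k.succ) fun r' k' hr' => ?_
    refine pure ⟨fun k => ?_, ?_⟩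
    · refine Fin.cases ?_ (fun k => ?_) k
      · exact hr.1
      · exact hr'.1 k
    · have h₁ := hr.2
      have h₂ := hr'.2
      rw [add_mul, one_mul]
      omega

end Spec

/-! ### Partitions -/

section Partitions

variable {Q X Ev : Type*}

/-- `C` is a partition of `s`. -/
structure IsPartition (s : Finset X) (C : Finset (Finset X)) : Prop where
  cell_subset : ∀ π ∈ C, π ⊆ s
  covers : ∀ x ∈ s, ∃ π ∈ C, x ∈ π
  nonempty : ∀ π ∈ C, π.Nonempty
  disjoint : ∀ π ∈ C, ∀ ρ ∈ C, π ≠ ρ → Disjoint π ρ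

theorem mem_cell {C : Finset (Finset X)} {x y : X} : y ∈ cell C x ↔ ∃ π ∈ C, x ∈ π ∧ y ∈ π := by
  simp [cell, and_assoc]

theorem IsControlCongruence.isPartition {G : Automaton Q Ev} {S : Automaton X Ev} {Sc : Finset Ev}
    {C : Finset (Finset X)} (h : IsControlCongruence G S Sc C) : IsPartition S.states C :=
  ⟨h.cell_subset, h.covers, h.nonempty, h.disjoint⟩

namespace IsPartition

variable {s : Finset X} {C : Finset (Finset X)} (h : IsPartition s C)
include h

theorem eq_of_mem {π ρ : Finset X} {x : X} (hπ : π ∈ C) (hρ : ρ ∈ C) (hx : x ∈ π) (hx' : x ∈ ρ) :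
    π = ρ := by
  by_contra hne
  exact Finset.disjoint_left.1 (h.disjoint _ hπ _ hρ hne) hx hx'

theorem cell_eq {π : Finset X} {x : X} (hπ : π ∈ C) (hx : x ∈ π) : cell C x = π := by
  ext y
  rw [mem_cell]
  constructor
  · rintro ⟨ρ, hρ, hxρ, hy⟩
    rwa [h.eq_of_mem hπ hρ hx hxρ]
  · exact fun hy => ⟨π, hπ, hx, hy⟩

theorem cell_mem {x : X} (hx : x ∈ s) : cell C x ∈ C := by
  obtain ⟨π, hπ, hxπ⟩ := h.covers x hx
  rwa [h.cell_eq hπ hxπ]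

theorem mem_cell_self {x : X} (hx : x ∈ s) : x ∈ cell C x := by
  obtain ⟨π, hπ, hxπ⟩ := h.covers x hx
  rwa [h.cell_eq hπ hxπ]

theorem cell_sub (x : X) : cell C x ⊆ s := by
  intro y hy
  obtain ⟨π, hπ, -, hyπ⟩ := mem_cell.1 hy
  exact h.cell_subset π hπ hyπ

theorem left_mem {x y : X} (hy : y ∈ cell C x) : x ∈ s := by
  obtain ⟨π, hπ, hx, -⟩ := mem_cell.1 hy
  exact h.cell_subset π hπ hx

theorem cell_eq_of_mem {x y : X} (hy : y ∈ cell C x) : cell C x = cell C y :=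
  (h.cell_eq (h.cell_mem (h.left_mem hy)) hy).symm

theorem mem_cell_iff {x y : X} (hy : y ∈ s) : y ∈ cell C x ↔ cell C x = cell C y :=
  ⟨h.cell_eq_of_mem, fun e => e ▸ h.mem_cell_self hy⟩

/-- Each isolation adds a cell, so this bound limits the number of rounds of `isolate`. -/
theorem card_le : C.card ≤ s.card := by
  have : C ⊆ s.image (cell C) := by
    intro π hπ
    obtain ⟨x, hx⟩ := h.nonempty π hπ
    exact Finset.mem_image.2 ⟨x, h.cell_subset π hπ hx, h.cell_eq hπ hx⟩
  exact (Finset.card_le_card this).trans Finset.card_image_le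

end IsPartition

/-- A partition into consistent cells that the transitions respect is a control congruence. -/
theorem IsPartition.isControlCongruence {C : Finset (Finset X)} {G : Automaton Q Ev} {S : Automaton X Ev}
    {Sc : Finset Ev} (h : IsPartition S.states C) (hS : S.Valid)
    (hcons : ∀ x, ∀ x' ∈ cell C x, Consistent G S Sc x x')
    (hsucc : ∀ x, ∀ x' ∈ cell C x, ∀ σ y y', S.trans x σ = some y → S.trans x' σ = some y' →
      cell C y = cell C y') : IsControlCongruence G S Sc C where
  cell_subset := h.cell_subset
  covers := h.covers
  nonempty := h.nonempty
  disjoint := h.disjoint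
  consistent π hπ x hx x' hx' := hcons x x' (by rwa [h.cell_eq hπ hx])
  successor π hπ σ _ := by
    rintro ⟨x, hx, y, hy⟩
    refine ⟨cell C y, h.cell_mem (hS.trans_mem _ _ _ hy).2.2, fun x' hx' y' hy' => ?_⟩
    rw [hsucc x x' (by rwa [h.cell_eq hπ hx]) σ y y' hy hy']
    exact h.mem_cell_self (hS.trans_mem _ _ _ hy').2.2

theorem IsControlCongruence.cell_succ_eq {G : Automaton Q Ev} {S : Automaton X Ev}
    {Sc : Finset Ev} {C : Finset (Finset X)} (h : IsControlCongruence G S Sc C) (hS : S.Valid)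
    {x x' y y' : X} {σ : Ev} (hx : x' ∈ cell C x) (hy : S.trans x σ = some y)
    (hy' : S.trans x' σ = some y') : cell C y = cell C y' := by
  have hp := h.isPartition
  have hxs := hp.left_mem hx
  obtain ⟨ρ, hρ, hall⟩ := h.successor _ (hp.cell_mem hxs) σ (hS.trans_mem _ _ _ hy).2.1
    ⟨x, hp.mem_cell_self hxs, y, hy⟩
  rw [hp.cell_eq hρ (hall x (hp.mem_cell_self hxs) y hy), hp.cell_eq hρ (hall x' hx y' hy')]

theorem IsControlCongruence.consistent_of_mem {G : Automaton Q Ev} {S : Automaton X Ev}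
    {Sc : Finset Ev} {C : Finset (Finset X)} (h : IsControlCongruence G S Sc C)
    {x x' : X} (hx : x' ∈ cell C x) : Consistent G S Sc x x' := by
  have hp := h.isPartition
  have hxs := hp.left_mem hx
  exact h.consistent _ (hp.cell_mem hxs) x (hp.mem_cell_self hxs) x' hx

/-- The partition into the classes of an equivalence relation. -/
theorem isPartition_image_filter {s : Finset X} {E : X → X → Prop} (refl : ∀ x, E x x)
    (symm : ∀ x y, E x y → E y x)
    (trans : ∀ x ∈ s, ∀ y ∈ s, ∀ z ∈ s, E x y → E y z → E x z) :
    IsPartition s (s.image fun x => s.filter (E x)) := by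
  constructor
  · simp only [Finset.mem_image]
    rintro _ ⟨x, -, rfl⟩
    exact Finset.filter_subset _ _
  · exact fun x hx => ⟨_, Finset.mem_image_of_mem _ hx, by simp [hx, refl]⟩
  · simp only [Finset.mem_image]
    rintro _ ⟨x, hx, rfl⟩
    exact ⟨x, by simp [hx, refl]⟩
  · simp only [Finset.mem_image]
    rintro _ ⟨x, hx, rfl⟩ _ ⟨y, hy, rfl⟩ hne
    rw [Finset.disjoint_left]
    intro z hz hz'
    rw [Finset.mem_filter] at hz hz'
    apply hne
    have hxy : E x y := trans _ hx _ hz.1 _ hy hz.2 (symm _ _ hz'.2)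
    ext w
    simp only [Finset.mem_filter, and_congr_right_iff]
    exact fun hw => ⟨trans _ hy _ hx _ hw (symm _ _ hxy), trans _ hx _ hy _ hw hxy⟩

theorem consistent_self (G : Automaton Q Ev) (S : Automaton X Ev) (Sc : Finset Ev) (x : X) :
    Consistent G S Sc x x := by
  have : Disjoint (S.enabled x) (disabled G S Sc x) := by
    rw [Finset.disjoint_left]
    intro σ h h'
    simp only [Automaton.enabled, disabled, Finset.mem_filter] at h h'
    obtain ⟨y, hy⟩ := h.2
    rw [h'.2.1] at hy
    cases hy
  exact ⟨this, this, fun _ => Iff.rfl⟩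

theorem Consistent.symm {G : Automaton Q Ev} {S : Automaton X Ev} {Sc : Finset Ev} {x y : X}
    (h : Consistent G S Sc x y) : Consistent G S Sc y x :=
  ⟨h.2.1, h.1, fun e => (h.2.2 e.symm).symm⟩

end Partitions

/-! ### Completing pending mergers -/

section Completion

variable {X : Type*}

/-- The relation `H` with the neighbourhoods of `a` and `b` made into one clique. -/
def join (H : X → X → Prop) (p : X × X) (x y : X) : Prop :=
  H x y ∨ (H p.1 x ∨ H p.2 x) ∧ (H p.1 y ∨ H p.2 y)

theorem join_symm {H : X → X → Prop} (h : ∀ x y, H x y → H y x) (p : X × X) (x y : X) :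
    join H p x y → join H p y x :=
  Or.imp (h x y) And.symm

/-- Let P and R be the sets of neighbours of the components of `p` and `q`. If no component of `p`
is related to one of `q`, both sides add the cliques on P and on R; otherwise both add the clique on
P ∪ R. Transitivity must not be assumed here, because `H` lacks it while calls are open. -/
theorem join_comm {H : X → X → Prop} (symm : ∀ x y, H x y → H y x)
    (p q : X × X) : join (join H p) q = join (join H q) p := by
  have cross : ∀ p q : X × X, (H p.1 q.1 ∨ H p.2 q.1) ∨ (H p.1 q.2 ∨ H p.2 q.2) →
      (H q.1 p.1 ∨ H q.2 p.1) ∨ (H q.1 p.2 ∨ H q.2 p.2) := by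
    rintro p q ((h | h) | (h | h)) <;> simp [symm _ _ h]
  have unfold : ∀ p q : X × X, ∀ x y, join (join H p) q x y ↔
      (H x y ∨ (H p.1 x ∨ H p.2 x) ∧ (H p.1 y ∨ H p.2 y)) ∨
      ((H q.1 x ∨ H q.2 x) ∨
        ((H p.1 q.1 ∨ H p.2 q.1) ∨ (H p.1 q.2 ∨ H p.2 q.2)) ∧ (H p.1 x ∨ H p.2 x)) ∧
      ((H q.1 y ∨ H q.2 y) ∨
        ((H p.1 q.1 ∨ H p.2 q.1) ∨ (H p.1 q.2 ∨ H p.2 q.2)) ∧ (H p.1 y ∨ H p.2 y)) := by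
    intro p q x y
    have e : ∀ z, (join H p q.1 z ∨ join H p q.2 z) ↔ (H q.1 z ∨ H q.2 z) ∨
        ((H p.1 q.1 ∨ H p.2 q.1) ∨ (H p.1 q.2 ∨ H p.2 q.2)) ∧ (H p.1 z ∨ H p.2 z) := by
      intro z
      rw [join, join, or_or_or_comm, ← or_and_right]
    rw [join, e, e, join]
  ext x y
  rw [unfold, unfold, propext ⟨cross p q, cross q p⟩]
  by_cases c : (H q.1 p.1 ∨ H q.2 p.1) ∨ (H q.1 p.2 ∨ H q.2 p.2)
  · simp only [c, true_and]
    generalize (H p.1 x ∨ H p.2 x) = m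
    generalize (H p.1 y ∨ H p.2 y) = m'
    generalize (H q.1 x ∨ H q.2 x) = k
    generalize (H q.1 y ∨ H q.2 y) = k'
    tauto
  · simp only [c, false_and, or_false]
    exact or_right_comm

theorem join_trans {H : X → X → Prop} (symm : ∀ x y, H x y → H y x)
    (trans : ∀ x y z, H x y → H y z → H x z) (p : X × X) (x y z : X) :
    join H p x y → join H p y z → join H p x z := by
  rintro (h | ⟨h, h'⟩) (k | ⟨k, k'⟩)
  · exact Or.inl (trans _ _ _ h k)
  · exact Or.inr ⟨k.imp (fun e => trans _ _ _ e (symm _ _ h)) fun e => trans _ _ _ e (symm _ _ h),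
      k'⟩
  · exact Or.inr ⟨h, h'.imp (fun e => trans _ _ _ e k) fun e => trans _ _ _ e k⟩
  · exact Or.inr ⟨h, k'⟩

/-- The relation `H` after completion of a stack of mergers, innermost first. -/
def joinAll (L : List (X × X)) (H : X → X → Prop) : X → X → Prop := L.foldl join H

/-- A new call enters the stack as the innermost merger, but transitivity is known only for the
relation after all the others; this moves the new merger outermost, where `join_trans` applies. -/
theorem joinAll_join (L : List (X × X)) (p : X × X) : ∀ {H : X → X → Prop},
    (∀ x y, H x y → H y x) → joinAll L (join H p) = join (joinAll L H) p := by
  induction L with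
  | nil => exact fun _ => rfl
  | cons q L ih =>
    intro H symm
    change joinAll L (join (join H p) q) = join (joinAll L (join H q)) p
    rw [join_comm symm, ih (join_symm symm q)]

theorem joinAll_symm (L : List (X × X)) : ∀ {H : X → X → Prop},
    (∀ x y, H x y → H y x) → ∀ x y, joinAll L H x y → joinAll L H y x := by
  induction L with
  | nil => exact fun h => h
  | cons q L ih => exact fun h => ih (join_symm h q)

end Completion
/-! ### `check_merge` -/

section Waiting

variable {Q X Ev : Type} {G : Automaton Q Ev} {S : Automaton X Ev} {Sc : Finset Ev}
  {C : Finset (Finset X)} {W W' : Finset (X × X)}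

theorem Listed.symm {x y : X} (h : Listed W x y) : Listed W y x := Or.symm h

theorem Listed.mono {x y : X} (h : Listed W x y) (hW : W ⊆ W') : Listed W' x y :=
  Or.imp (@hW _) (@hW _) h

/-- The cells of `x` and `y` coincide or `W` contains a pair of states from these cells. -/
def Linked (C : Finset (Finset X)) (W : Finset (X × X)) (x y : X) : Prop :=
  cell C x = cell C y ∨ ∃ x' ∈ cell C x, ∃ y' ∈ cell C y, Listed W x' y'

theorem Linked.refl (x : X) : Linked C W x x := Or.inl rfl

theorem Linked.symm {x y : X} : Linked C W x y → Linked C W y x := by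
  rintro (h | ⟨x', hx, y', hy, h⟩)
  · exact Or.inl h.symm
  · exact Or.inr ⟨y', hy, x', hx, h.symm⟩

theorem Linked.mono {x y : X} (h : Linked C W x y) (hW : W ⊆ W') : Linked C W' x y :=
  h.imp id fun ⟨x', hx, y', hy, h⟩ => ⟨x', hx, y', hy, h.mono hW⟩

theorem Linked.of_cell_eq {x y z : X} (h : Linked C W x y) (e : cell C y = cell C z) :
    Linked C W x z := by
  rwa [Linked, ← e]

theorem IsPartition.linked_of_listed {s : Finset X} (h : IsPartition s C) {x y : X} (hx : x ∈ s)
    (hy : y ∈ s) (hxy : Listed W x y) : Linked C W x y :=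
  Or.inr ⟨x, h.mem_cell_self hx, y, h.mem_cell_self hy, hxy⟩

theorem IsPartition.mem_of_linked {s : Finset X} (h : IsPartition s C) {x y : X} (hx : x ∈ s)
    (hxy : Linked C W x y) : y ∈ s := by
  rcases hxy with e | ⟨-, -, y', hy, -⟩
  · exact h.left_mem (e ▸ h.mem_cell_self hx)
  · exact h.left_mem hy

/-- Identifies the set N(a) of the algorithm with a neighbourhood in the graph of `Linked`, so that
the invariant can be stated without `near`. -/
theorem IsPartition.mem_near (h : IsPartition S.states C) {a y : X} (ha : a ∈ S.states) :
    y ∈ near S C W a ↔ Linked C W a y := by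
  simp only [near, Finset.mem_union, Finset.mem_biUnion, Finset.mem_filter]
  constructor
  · rintro (hy | ⟨x, ⟨hx, a', ha', hxa⟩, hy⟩)
    · exact Or.inl (h.cell_eq_of_mem hy)
    · refine Or.inr ⟨a', ha', x, ?_, hxa.symm⟩
      rw [← h.cell_eq_of_mem hy]
      exact h.mem_cell_self hx
  · intro hl
    have hy := h.mem_of_linked ha hl
    rcases hl with e | ⟨x', hx', y', hy', hl⟩
    · exact Or.inl ((h.mem_cell_iff hy).2 e)
    · refine Or.inr ⟨y', ⟨h.cell_sub _ hy', x', hx', hl.symm⟩, ?_⟩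
      rw [← h.cell_eq_of_mem hy']
      exact h.mem_cell_self hy

/-- Joining at `p` does not enlarge the union of the neighbourhoods of its two components, so any
relation in between has the same union and yields the same clique. -/
theorem join_eq_of_le {H H' : X → X → Prop} {p : X × X} (h : ∀ x y, H x y → H' x y)
    (h' : ∀ x y, H' x y → join H p x y) : join H' p = join H p := by
  have e : ∀ z, (H' p.1 z ∨ H' p.2 z) ↔ (H p.1 z ∨ H p.2 z) := fun z =>
    ⟨Or.rec (fun hz => (h' _ _ hz).elim Or.inl And.right)
      fun hz => (h' _ _ hz).elim Or.inr And.right, Or.imp (h _ _) (h _ _)⟩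
  ext x y
  rw [join, e, e]
  exact ⟨Or.rec (h' x y) Or.inr, Or.imp (h x y) id⟩

theorem IsPartition.join_linked_insert {s : Finset X} (h : IsPartition s C) {a b p q : X}
    (hp : Linked C W a p) (hq : Linked C W b q) :
    join (Linked C (insert (p, q) W)) (a, b) = join (Linked C W) (a, b) := by
  refine join_eq_of_le (fun x y hl => hl.mono (Finset.subset_insert _ _)) ?_
  have hp' : ∀ x, p ∈ cell C x → Linked C W a x := fun x hx =>
    hp.of_cell_eq (h.cell_eq_of_mem hx).symm
  have hq' : ∀ x, q ∈ cell C x → Linked C W b x := fun x hx =>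
    hq.of_cell_eq (h.cell_eq_of_mem hx).symm
  rintro x y (e | ⟨x', hx, y', hy, hl | hl⟩)
  · exact Or.inl (Or.inl e)
  · rcases Finset.mem_insert.1 hl with e | hl
    · obtain ⟨rfl, rfl⟩ := Prod.mk.inj e
      exact Or.inr ⟨Or.inl (hp' _ hx), Or.inr (hq' _ hy)⟩
    · exact Or.inl (Or.inr ⟨x', hx, y', hy, Or.inl hl⟩)
  · rcases Finset.mem_insert.1 hl with e | hl
    · obtain ⟨rfl, rfl⟩ := Prod.mk.inj e
      exact Or.inr ⟨Or.inr (hq' _ hx), Or.inl (hp' _ hy)⟩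
    · exact Or.inl (Or.inr ⟨x', hx, y', hy, Or.inr hl⟩)

/-- As `b` lies in its own neighbourhood, every neighbour of `a` is listed with `b`, and vice versa.
The two neighbourhoods therefore coincide and already form a clique: a completed call can be dropped
from the stack. -/
theorem IsPartition.join_linked_eq {s : Finset X} (h : IsPartition s C) {a b : X} (ha : a ∈ s)
    (hb : b ∈ s) (hab : ∀ x y, Linked C W a x → Linked C W b y → Listed W x y) :
    join (Linked C W) (a, b) = Linked C W := by
  have key₁ : ∀ x, Linked C W a x → Linked C W b x := fun x hx =>
    h.linked_of_listed hb (h.mem_of_linked ha hx) (hab x b hx (Linked.refl b)).symm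
  have key₂ : ∀ x, Linked C W b x → Linked C W a x := fun x hx =>
    h.linked_of_listed ha (h.mem_of_linked hb hx) (hab a x (Linked.refl a) hx)
  ext x y
  refine ⟨?_, Or.inl⟩
  rintro (hl | ⟨hx, hy⟩)
  · exact hl
  · have hx := hx.elim id (key₂ x)
    have hy := hy.elim (key₁ y) id
    exact h.linked_of_listed (h.mem_of_linked ha hx) (h.mem_of_linked hb hy) (hab x y hx hy)

/-- `W'` arises from `W` by adding consistent pairs together with all pairs of states from the
same cells, such that distinct cells of successors are in `W'`, too. -/
structure Extends (G : Automaton Q Ev) (S : Automaton X Ev) (Sc : Finset Ev)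
    (C : Finset (Finset X)) (W W' : Finset (X × X)) : Prop where
  subset : W ⊆ W'
  consistent : ∀ p ∈ W', p ∉ W → Consistent G S Sc p.1 p.2
  saturated : ∀ p ∈ W', p ∉ W → ∀ x ∈ cell C p.1, ∀ y ∈ cell C p.2, Listed W' x y
  successor : ∀ p ∈ W', p ∉ W → ∀ σ u v, S.trans p.1 σ = some u → S.trans p.2 σ = some v →
    cell C u = cell C v ∨ Listed W' u v

theorem Extends.refl (W : Finset (X × X)) : Extends G S Sc C W W :=
  ⟨subset_rfl, fun _ h h' => absurd h h', fun _ h h' => absurd h h', fun _ h h' => absurd h h'⟩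

theorem Extends.trans {W'' : Finset (X × X)} (h : Extends G S Sc C W W')
    (h' : Extends G S Sc C W' W'') : Extends G S Sc C W W'' where
  subset := h.subset.trans h'.subset
  consistent p hp hn :=
    if h₁ : p ∈ W' then h.consistent p h₁ hn else h'.consistent p hp h₁
  saturated p hp hn x hx y hy :=
    if h₁ : p ∈ W' then (h.saturated p h₁ hn x hx y hy).mono h'.subset
    else h'.saturated p hp h₁ x hx y hy
  successor p hp hn σ u v hu hv :=
    if h₁ : p ∈ W' then (h.successor p h₁ hn σ u v hu hv).imp id fun e => e.mono h'.subset
    else h'.successor p hp h₁ σ u v hu hv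

theorem Extends.of_insert {p : X × X} (h : Extends G S Sc C (insert p W) W')
    (hc : Consistent G S Sc p.1 p.2)
    (hs : ∀ x ∈ cell C p.1, ∀ y ∈ cell C p.2, Listed W' x y)
    (hsucc : ∀ σ u v, S.trans p.1 σ = some u → S.trans p.2 σ = some v →
      cell C u = cell C v ∨ Listed W' u v) : Extends G S Sc C W W' where
  subset := (Finset.subset_insert _ _).trans h.subset
  consistent q hq hn := by
    by_cases e : q = p
    · rwa [e]
    · exact h.consistent q hq (by simp [e, hn])
  saturated q hq hn := by
    by_cases e : q = p
    · rwa [e]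
    · exact h.saturated q hq (by simp [e, hn])
  successor q hq hn := by
    by_cases e : q = p
    · rwa [e]
    · exact h.successor q hq (by simp [e, hn])

end Waiting

/-! ### Invariant, termination and amortised cost of `check_merge`. -/

section CheckMerge

variable {Q X Ev : Type} {N : ℕ}

/-- What holds when `check_merge` or its loop over the events ends with `r` after `k` operations,
except for `slack` operations. Here `L` is the stack of calls that are not completed. -/
structure Progress (G : Automaton Q Ev) (S : Automaton X Ev) (Sc : Finset Ev)
    (C : Finset (Finset X)) (L : List (X × X)) (W : Finset (X × X)) (slack : ℕ)
    (r : Bool × Finset (X × X)) (k : ℕ) : Prop where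
  subset : W ⊆ r.2
  states : r.2 ⊆ S.states ×ˢ S.states
  -- Each inserted pair pays for its test and its insertion, 1 + |Σ'| each including the common
  -- events, and for examining at most |Σ'| events with one call each. The last summand covers a
  -- failed test, which inserts nothing and occurs at most once since failure propagates at once.
  cost : k + (4 * S.events.card + 2) * W.card ≤
    (4 * S.events.card + 2) * r.2.card + slack + if r.1 then 0 else 1 + S.events.card
  extend : r.1 = true → Extends G S Sc C W r.2
  trans : r.1 = true → ∀ x y z, joinAll L (Linked C r.2) x y → joinAll L (Linked C r.2) y z →
    joinAll L (Linked C r.2) x z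

variable {G : Automaton Q Ev} {S : Automaton X Ev} {Sc : Finset Ev} {C : Finset (Finset X)}

/-- The bound `d` on the size of `W` lets the caller supply nested calls from its induction
hypothesis. The slack of 2 per event, one for examining it and one for the call, is prepaid by the
pair inserted just before. -/
theorem eventLoop_spec (hS : S.Valid) {num : Fin N → X} {i : Fin N} {L : List (X × X)} {d : ℕ}
    {call : ℕ → X → X → Finset (X × X) → Counted (Bool × Finset (X × X))} {p q : X}
    (hcall : ∀ u ∈ S.states, ∀ v ∈ S.states, ∀ W ⊆ S.states ×ˢ S.states, d ≤ W.card →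
      (∀ x y z, joinAll L (Linked C W) x y → joinAll L (Linked C W) y z →
        joinAll L (Linked C W) x z) →
      Spec (fun f => call f u v W) fun r k =>
        Progress G S Sc C L W 0 r k ∧ (r.1 = true → Listed r.2 u v)) :
    ∀ (l : List Ev) (W : Finset (X × X)), W ⊆ S.states ×ˢ S.states → d ≤ W.card →
      (∀ x y z, joinAll L (Linked C W) x y → joinAll L (Linked C W) y z →
        joinAll L (Linked C W) x z) →
      Spec (fun f => eventLoop S num C i (call f) p q l W) fun r k =>
        Progress G S Sc C L W (2 * l.length) r k ∧
        (r.1 = true → ∀ σ ∈ l, ∀ u v, S.trans p σ = some u → S.trans q σ = some v →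
          cell C u = cell C v ∨ Listed r.2 u v)
  | [], W, hW, _, ht => by
    simp only [eventLoop]
    exact Spec.pure ⟨⟨subset_rfl, hW, by simp, fun _ => Extends.refl W, fun _ => ht⟩, by simp⟩
  | σ :: l, W, hW, hd, ht => by
    have skip : ∀ c, c ≤ 1 → (∀ u v, S.trans p σ = some u → S.trans q σ = some v →
          cell C u = cell C v ∨ Listed W u v) →
        Spec (fun f => eventLoop S num C i (call f) p q l W) fun r k =>
          Progress G S Sc C L W (2 * (σ :: l).length) r (c + k) ∧
          (r.1 = true → ∀ τ ∈ σ :: l, ∀ u v, S.trans p τ = some u → S.trans q τ = some v →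
            cell C u = cell C v ∨ Listed r.2 u v) := by
      intro c hc hn
      refine (eventLoop_spec hS hcall l W hW hd ht).mono fun r k ⟨hr, hr'⟩ => ?_
      refine ⟨⟨hr.subset, hr.states, ?_, hr.extend, hr.trans⟩, fun hr₁ τ hτ u v hu hv => ?_⟩
      · have := hr.cost
        rw [List.length_cons]
        omega
      · rcases List.mem_cons.1 hτ with rfl | hτ
        · exact (hn u v hu hv).imp id fun e => e.mono hr.subset
        · exact hr' hr₁ τ hτ u v hu hv
    rcases hu : S.trans p σ with _ | u
    · simp only [eventLoop, hu]
      simpa using skip 0 (by omega) (by simp [hu])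
    rcases hv : S.trans q σ with _ | v
    · simp only [eventLoop, hu, hv]
      simpa using skip 0 (by omega) (by simp [hv])
    simp only [eventLoop, hu, hv]
    refine Spec.charge ?_
    by_cases h₁ : cell C u = cell C v ∨ Listed W u v
    · simp only [if_pos h₁]
      refine skip 1 le_rfl fun u' v' hu' hv' => ?_
      rw [hu] at hu'
      rw [hv] at hv'
      cases hu'
      cases hv'
      exact h₁
    simp only [if_neg h₁]
    by_cases h₂ : HasSmaller num C u i ∨ HasSmaller num C v i
    · simp only [if_pos h₂]
      exact Spec.pure ⟨⟨subset_rfl, hW, by simp; omega, by simp, by simp⟩, by simp⟩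
    simp only [if_neg h₂]
    refine Spec.charge ?_
    refine Spec.bind (hcall u (hS.trans_mem _ _ _ hu).2.2 v (hS.trans_mem _ _ _ hv).2.2 W hW hd ht)
      fun r k ⟨hr, hr'⟩ => ?_
    by_cases h₃ : r.1 = true
    · simp only [if_pos h₃]
      refine (eventLoop_spec hS hcall l r.2 hr.states
        (hd.trans (Finset.card_le_card hr.subset)) (hr.trans h₃)).mono fun r' k' ⟨hq, hq'⟩ => ?_
      refine ⟨⟨hr.subset.trans hq.subset, hq.states, ?_,
        fun h => (hr.extend h₃).trans (hq.extend h), hq.trans⟩, fun h τ hτ u' v' hu' hv' => ?_⟩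
      · have h₄ := hr.cost
        have h₅ := hq.cost
        rw [if_pos h₃] at h₄
        rw [List.length_cons]
        omega
      · rcases List.mem_cons.1 hτ with rfl | hτ
        · rw [hu] at hu'
          rw [hv] at hv'
          cases hu'
          cases hv'
          exact Or.inr ((hr' h₃).mono hq.subset)
        · exact hq' h τ hτ u' v' hu' hv'
    · simp only [if_neg h₃]
      refine Spec.pure ⟨⟨hr.subset, hr.states, ?_, by simp, by simp⟩, by simp⟩
      have h₄ := hr.cost
      rw [if_neg h₃] at h₄
      rw [List.length_cons]
      simp only [Bool.false_eq_true, if_false]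
      omega

/-- Induction on a bound `d` for the number of pairs of states not yet in `W`. Nested calls and the
next iteration both start after an insertion, hence with a smaller bound. -/
theorem checkMerge_spec (hS : S.Valid) (hC : IsPartition S.states C) (ord : LoopOrder X Ev)
    (num : Fin N → X) (i : Fin N) : ∀ (d : ℕ) (L : List (X × X)) (a b : X) (W : Finset (X × X)),
      a ∈ S.states → b ∈ S.states → W ⊆ S.states ×ˢ S.states → S.states.card ^ 2 ≤ W.card + d →
      (∀ x y z, joinAll L (join (Linked C W) (a, b)) x y →
        joinAll L (join (Linked C W) (a, b)) y z → joinAll L (join (Linked C W) (a, b)) x z) →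
      Spec (fun f => checkMerge ord G S Sc num C i f a b W) fun r k =>
        Progress G S Sc C L W 0 r k ∧
        (r.1 = true → ∀ x y, Linked C r.2 a x → Linked C r.2 b y → Listed r.2 x y) := by
  intro d
  induction d with
  | zero =>
    intro L a b W ha hb hW hd ht
    have hWe : W = S.states ×ˢ S.states := Finset.eq_of_subset_of_card_le hW (by
      rw [Finset.card_product, ← sq]; exact hd)
    have hl : ∀ x y, Linked C W a x → Linked C W b y → Listed W x y := fun x y hx hy =>
      Or.inl (by
        rw [hWe]
        exact Finset.mk_mem_product (hC.mem_of_linked ha hx) (hC.mem_of_linked hb hy))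
    have hp : ¬ (pending S C W a b).Nonempty := by
      rintro ⟨x, hx⟩
      obtain ⟨hx, hx'⟩ := Finset.mem_filter.1 hx
      obtain ⟨h₁, h₂⟩ := Finset.mem_product.1 hx
      exact hx' (hl _ _ ((hC.mem_near ha).1 h₁) ((hC.mem_near hb).1 h₂))
    refine Spec.of_succ ?_
    simp only [checkMerge, if_neg hp]
    rw [hC.join_linked_eq ha hb hl] at ht
    exact Spec.pure ⟨⟨subset_rfl, hW, by simp, fun _ => Extends.refl W, fun _ => ht⟩,
      fun _ => hl⟩
  | succ d ih =>
    intro L a b W ha hb hW hd ht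
    refine Spec.of_succ ?_
    by_cases hp : (pending S C W a b).Nonempty
    swap
    · have hl : ∀ x y, Linked C W a x → Linked C W b y → Listed W x y := by
        intro x y hx hy
        by_contra hn
        exact hp ⟨(x, y), Finset.mem_filter.2 ⟨Finset.mk_mem_product ((hC.mem_near ha).2 hx)
          ((hC.mem_near hb).2 hy), hn⟩⟩
      simp only [checkMerge, if_neg hp]
      rw [hC.join_linked_eq ha hb hl] at ht
      exact Spec.pure ⟨⟨subset_rfl, hW, by simp, fun _ => Extends.refl W, fun _ => ht⟩,
        fun _ => hl⟩
    simp only [checkMerge, if_pos hp]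
    have hm := ord.pair_mem _ hp
    generalize ord.pair (pending S C W a b) = pq at hm
    obtain ⟨p, q⟩ := pq
    obtain ⟨hm, hn⟩ := Finset.mem_filter.1 hm
    obtain ⟨hpa, hqb⟩ := Finset.mem_product.1 hm
    rw [hC.mem_near ha] at hpa
    rw [hC.mem_near hb] at hqb
    have hps := hC.mem_of_linked ha hpa
    have hqs := hC.mem_of_linked hb hqb
    have hnW : (p, q) ∉ W := fun h => hn (Or.inl h)
    refine Spec.charge ?_
    by_cases hc : Consistent G S Sc p q
    swap
    · simp only [if_pos hc]
      refine Spec.pure ⟨⟨subset_rfl, hW, ?_, by simp, by simp⟩, by simp⟩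
      simp only [Bool.false_eq_true, if_false]
      omega
    simp only [not_true, hc, if_false]
    refine Spec.charge ?_
    have hcard : (insert (p, q) W).card = W.card + 1 := Finset.card_insert_of_notMem hnW
    have hW' : insert (p, q) W ⊆ S.states ×ˢ S.states :=
      Finset.insert_subset (Finset.mk_mem_product hps hqs) hW
    have hlen : (ord.events (S.enabled p ∩ S.enabled q)).length ≤ S.events.card := by
      rw [← List.toFinset_card_of_nodup (ord.events_nodup _)]
      refine Finset.card_le_card fun σ hσ => ?_
      rw [List.mem_toFinset, ord.mem_events] at hσ
      exact (Finset.mem_filter.1 (Finset.mem_inter.1 hσ).1).1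
    have hjoin := hC.join_linked_insert (W := W) hpa hqb
    -- Calls for successors run with `(a, b)` still open, hence pushed on the stack, and with a
    -- waiting list of at least `W.card + 1` pairs.
    have hev := eventLoop_spec (G := G) (Sc := Sc) (C := C) hS (num := num) (i := i)
      (L := (a, b) :: L) (d := W.card + 1) (p := p) (q := q)
      (call := fun f => checkMerge ord G S Sc num C i f) (by
        intro u hu v hv W₁ hW₁ hd₁ ht₁
        refine (ih ((a, b) :: L) u v W₁ hu hv hW₁ (by omega) ?_).mono
          fun r k hr => ⟨hr.1, fun h => hr.2 h u v (Linked.refl u) (Linked.refl v)⟩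
        rw [joinAll_join _ _ fun _ _ => Linked.symm]
        exact join_trans (joinAll_symm _ fun _ _ => Linked.symm) ht₁ _)
      (ord.events (S.enabled p ∩ S.enabled q)) (insert (p, q) W) hW' hcard.ge (by
        change ∀ x y z, joinAll L (join _ (a, b)) x y → joinAll L (join _ (a, b)) y z →
          joinAll L (join _ (a, b)) x z
        rwa [hjoin])
    refine Spec.bind hev fun r k ⟨hr, hr'⟩ => ?_
    have hcost := hr.cost
    rw [hcard, mul_add, mul_one] at hcost
    by_cases h₃ : r.1 = true
    · simp only [if_pos h₃]
      rw [if_pos h₃] at hcost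
      have hle := Finset.card_le_card hr.subset
      refine (ih L a b r.2 ha hb hr.states (by omega) (hr.trans h₃)).mono
        fun r' k' ⟨hq, hq'⟩ => ?_
      have hsub : insert (p, q) W ⊆ r'.2 := hr.subset.trans hq.subset
      have hsub' : W ⊆ r'.2 := (Finset.subset_insert _ _).trans hsub
      refine ⟨⟨hsub', hq.states, ?_, fun h => ?_, hq.trans⟩, hq'⟩
      · have := hq.cost
        omega
      · refine Extends.of_insert ((hr.extend h₃).trans (hq.extend h)) hc ?_ ?_
        -- The cells of `p` and `q` lie entirely in N(a) and N(b), whose product is listed when the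
        -- call on `(a, b)` succeeds.
        · intro x hx y hy
          exact hq' h x y ((hpa.mono hsub').of_cell_eq (hC.cell_eq_of_mem hx))
            ((hqb.mono hsub').of_cell_eq (hC.cell_eq_of_mem hy))
        · intro σ u v hu hv
          refine (hr' h₃ σ ?_ u v hu hv).imp id fun e => e.mono hq.subset
          have hσ := (hS.trans_mem _ _ _ hu).2.1
          rw [ord.mem_events, Finset.mem_inter]
          exact ⟨Finset.mem_filter.2 ⟨hσ, u, hu⟩, Finset.mem_filter.2 ⟨hσ, v, hv⟩⟩
    · simp only [if_neg h₃]
      rw [if_neg h₃] at hcost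
      refine Spec.pure ⟨⟨(Finset.subset_insert _ _).trans hr.subset, hr.states, ?_, by simp,
        by simp⟩, by simp⟩
      simp only [Bool.false_eq_true, if_false]
      omega

end CheckMerge
/-! ### `localize` -/

section Localize

variable {Q X Ev : Type} {G : Automaton Q Ev} {S : Automaton X Ev} {Sc : Finset Ev}
  {C : Finset (Finset X)}

theorem linked_empty_trans (x y z : X) (h : Linked C ∅ x y) (h' : Linked C ∅ y z) :
    Linked C ∅ x z := by
  simp only [Linked, Listed, Finset.notMem_empty, or_self, and_false, exists_false, or_false]
    at h h' ⊢
  exact h.trans h'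

/-- Needed because `mergeCells` and the conditions in `Extends` speak of listed states, whereas the
equivalence relation is `Linked`. -/
theorem Extends.listed_of_linked {W : Finset (X × X)} (h : Extends G S Sc C ∅ W)
    (hC : IsPartition S.states C) {x y : X} (hx : x ∈ S.states) (hy : y ∈ S.states)
    (hl : Linked C W x y) : cell C x = cell C y ∨ Listed W x y := by
  rcases hl with e | ⟨x', hx', y', hy', hl⟩
  · exact Or.inl e
  · have hx'' : x ∈ cell C x' := (hC.mem_cell_iff hx).2 (hC.cell_eq_of_mem hx').symm
    have hy'' : y ∈ cell C y' := (hC.mem_cell_iff hy).2 (hC.cell_eq_of_mem hy').symm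
    rcases hl with hl | hl
    · exact Or.inr (h.saturated _ hl (Finset.notMem_empty _) x hx'' y hy'')
    · exact Or.inr (h.saturated _ hl (Finset.notMem_empty _) y hy'' x hx'').symm

theorem mergeCells_eq {W : Finset (X × X)} (hC : IsPartition S.states C)
    (hE : Extends G S Sc C ∅ W) :
    mergeCells S C W = S.states.image fun x => S.states.filter (Linked C W x) := by
  refine Finset.image_congr fun x hx => ?_
  have hx : x ∈ S.states := hx
  ext y
  simp only [Finset.mem_union, Finset.mem_biUnion, Finset.mem_filter]
  constructor
  · rintro (hy | ⟨x', ⟨hx', hl⟩, hy⟩)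
    · exact ⟨hC.cell_sub _ hy, Or.inl (hC.cell_eq_of_mem hy)⟩
    · exact ⟨hC.cell_sub _ hy, (hC.linked_of_listed hx hx' hl).of_cell_eq (hC.cell_eq_of_mem hy)⟩
  · rintro ⟨hy, hl⟩
    rcases hE.listed_of_linked hC hx hy hl with e | hl
    · exact Or.inl ((hC.mem_cell_iff hy).2 e)
    · exact Or.inr ⟨y, ⟨hy, hl⟩, hC.mem_cell_self hy⟩

/-- Two states of a merged cell share an old cell or are listed. Consistency and linked successors
come from the old congruence in the first case and from `Extends` in the second. -/
theorem mergeCells_isControlCongruence {W : Finset (X × X)} (hS : S.Valid)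
    (hC : IsControlCongruence G S Sc C) (hE : Extends G S Sc C ∅ W)
    (ht : ∀ x y z, Linked C W x y → Linked C W y z → Linked C W x z) :
    IsControlCongruence G S Sc (mergeCells S C W) := by
  have hp := hC.isPartition
  rw [mergeCells_eq hp hE]
  have hP := isPartition_image_filter (s := S.states) (E := Linked C W) Linked.refl
    (fun _ _ => Linked.symm) fun x _ y _ z _ => ht x y z
  set C' := S.states.image fun x => S.states.filter (Linked C W x) with hC'
  have hcell : ∀ x, ∀ x' ∈ cell C' x, cell C x = cell C x' ∨ Listed W x x' := by
    intro x x' hx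
    refine hE.listed_of_linked hp (hP.left_mem hx) (hP.cell_sub _ hx) ?_
    obtain ⟨π, hπ, h, h'⟩ := mem_cell.1 hx
    obtain ⟨z, -, rfl⟩ := Finset.mem_image.1 hπ
    exact ht _ _ _ (Finset.mem_filter.1 h).2.symm (Finset.mem_filter.1 h').2
  have hlinked : ∀ y ∈ S.states, ∀ y' ∈ S.states, Linked C W y y' → cell C' y = cell C' y' := by
    intro y hy y' hy' hl
    refine hP.cell_eq_of_mem (mem_cell.2 ⟨S.states.filter (Linked C W y), ?_, ?_, ?_⟩)
    · exact Finset.mem_image_of_mem _ hy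
    · exact Finset.mem_filter.2 ⟨hy, Linked.refl y⟩
    · exact Finset.mem_filter.2 ⟨hy', hl⟩
  refine hP.isControlCongruence hS ?_ ?_
  · intro x x' hx
    rcases hcell x x' hx with e | h | h
    · exact hC.consistent_of_mem ((hp.mem_cell_iff (hP.cell_sub _ hx)).2 e)
    · exact hE.consistent _ h (Finset.notMem_empty _)
    · exact (hE.consistent _ h (Finset.notMem_empty _)).symm
  · intro x x' hx σ y y' hy hy'
    have hys := (hS.trans_mem _ _ _ hy).2.2
    have hys' := (hS.trans_mem _ _ _ hy').2.2
    refine hlinked y hys y' hys' ?_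
    rcases hcell x x' hx with e | h | h
    · exact Or.inl (hC.cell_succ_eq hS ((hp.mem_cell_iff (hP.cell_sub _ hx)).2 e) hy hy')
    · exact (hE.successor _ h (Finset.notMem_empty _) σ y y' hy hy').elim Or.inl
        (hp.linked_of_listed hys hys')
    · refine Linked.symm ?_
      exact (hE.successor _ h (Finset.notMem_empty _) σ y' y hy' hy).elim Or.inl
        (hp.linked_of_listed hys' hys)

theorem localize_spec {N : ℕ} (hS : S.Valid) (hC : IsControlCongruence G S Sc C)
    (ord : LoopOrder X Ev) (num : Fin N → X) (hnum : ∀ i, num i ∈ S.states) :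
    Spec (fun f => localize ord G S Sc num f C) fun r k => IsControlCongruence G S Sc r ∧
      k ≤ N * (1 + N * (3 + ((4 * S.events.card + 2) * S.states.card ^ 2 + S.events.card) +
        S.states.card ^ 2)) := by
  set B := (4 * S.events.card + 2) * S.states.card ^ 2 + S.events.card with hB
  have hmain := Spec.foldlM (step := fun f C i => (do
      charge 1
      if HasSmaller num C (num i) i then pure C
      else
        ((List.finRange N).filter fun j => i < j).foldlM (fun C j => do
          charge 1
          if HasSmaller num C (num j) j then pure C
          else do
            charge 1
            let r ← checkMerge ord G S Sc num C i f (num i) (num j) ∅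
            if r.1 then do
              charge (S.states.card ^ 2)
              pure (mergeCells S C r.2)
            else
              pure C) C : Counted (Finset (Finset X))))
    (Inv := IsControlCongruence G S Sc) (c := 1 + N * (3 + B + S.states.card ^ 2))
    (List.finRange N) C hC (by
      intro C i _ hC
      refine Spec.charge ?_
      by_cases h : HasSmaller num C (num i) i
      · simp only [if_pos h]
        exact Spec.pure ⟨hC, by omega⟩
      simp only [if_neg h]
      refine (Spec.foldlM (Inv := IsControlCongruence G S Sc) (c := 3 + B + S.states.card ^ 2)
        _ C hC ?_).mono fun r k hr => ⟨hr.1, ?_⟩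
      · intro C j _ hC
        refine Spec.charge ?_
        by_cases h : HasSmaller num C (num j) j
        · simp only [if_pos h]
          exact Spec.pure ⟨hC, by omega⟩
        simp only [if_neg h]
        refine Spec.charge ?_
        refine Spec.bind (checkMerge_spec hS hC.isPartition ord num i (S.states.card ^ 2) []
          (num i) (num j) ∅ (hnum i) (hnum j) (Finset.empty_subset _) (by simp)
          (join_trans (fun _ _ => Linked.symm) linked_empty_trans _)) fun r k ⟨hr, _⟩ => ?_
        have hcard := Finset.card_le_card hr.states
        rw [Finset.card_product, ← sq] at hcard
        have hmul := Nat.mul_le_mul_left (4 * S.events.card + 2) hcard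
        -- The 1 and the summand |Σ'| in `B` pay for a possible failed consistency test; with the
        -- two charges before the call this makes the constant 3.
        have hk : k ≤ 1 + B := by
          have := hr.cost
          rw [Finset.card_empty] at this
          split_ifs at this <;> omega
        by_cases h : r.1 = true
        · simp only [if_pos h]
          refine Spec.charge (Spec.pure ⟨?_, by omega⟩)
          exact mergeCells_isControlCongruence hS hC (hr.extend h) (hr.trans h)
        · simp only [if_neg h]
          exact Spec.pure ⟨hC, by omega⟩
      · have hlen : ((List.finRange N).filter fun j => i < j).length ≤ N :=
          (List.length_filter_le _ _).trans (List.length_finRange).le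
        have := Nat.mul_le_mul_right (3 + B + S.states.card ^ 2) hlen
        have := hr.2
        omega)
  rw [List.length_finRange] at hmain
  exact hmain

end Localize

/-! ### `isolate` -/

section Isolate

variable {Q X Ev : Type}

/-- `C` is a partition of `s` in which the elements outside `old` form singletons. -/
structure IsIsolated (old s : Finset X) (C : Finset (Finset X)) : Prop extends
    IsPartition s C where
  singleton : ∀ π ∈ C, ∀ x ∈ π, x ∉ old → π = {x}

theorem isIsolated_singletonCover (old s : Finset X) :
    IsIsolated old s (s.image fun x => {x}) := by
  constructor
  · constructor
    · simp
    · simp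
    · simp
    · simp only [Finset.mem_image]
      rintro _ ⟨x, -, rfl⟩ _ ⟨y, -, rfl⟩ h
      rw [Finset.disjoint_singleton]
      rintro rfl
      exact h rfl
  · simp only [Finset.mem_image]
    rintro _ ⟨x, -, rfl⟩ y hy -
    rw [Finset.mem_singleton.1 hy]

theorem isIsolated_isolateInit {old : Finset X} {C : Finset (Finset X)} (h : IsPartition old C)
    (new : Finset X) : IsIsolated old new (isolateInit C old new) := by
  have hmem : ∀ π, π ∈ isolateInit C old new ↔
      (π.Nonempty ∧ ∃ ρ ∈ C, ρ \ (old \ new) = π) ∨ ∃ x ∈ new \ old, {x} = π := by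
    intro π
    simp [isolateInit, Finset.nonempty_iff_ne_empty]
  have hcut : ∀ ρ ∈ C, ∀ x, x ∈ ρ \ (old \ new) ↔ x ∈ ρ ∧ x ∈ new := by
    intro ρ hρ x
    have hρx : x ∈ ρ → x ∈ old := fun hx => h.cell_subset ρ hρ hx
    simp only [Finset.mem_sdiff]
    tauto
  constructor
  · constructor
    · intro π hπ x hx
      rcases (hmem π).1 hπ with ⟨-, ρ, hρ, rfl⟩ | ⟨y, hy, rfl⟩
      · exact ((hcut ρ hρ x).1 hx).2
      · rw [Finset.mem_singleton.1 hx]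
        exact (Finset.mem_sdiff.1 hy).1
    · intro x hx
      by_cases hxo : x ∈ old
      · obtain ⟨ρ, hρ, hxρ⟩ := h.covers x hxo
        have := (hcut ρ hρ x).2 ⟨hxρ, hx⟩
        exact ⟨_, (hmem _).2 (Or.inl ⟨⟨x, this⟩, ρ, hρ, rfl⟩), this⟩
      · exact ⟨{x}, (hmem _).2 (Or.inr ⟨x, Finset.mem_sdiff.2 ⟨hx, hxo⟩, rfl⟩), by simp⟩
    · intro π hπ
      rcases (hmem π).1 hπ with ⟨hne, -⟩ | ⟨y, -, rfl⟩
      · exact hne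
      · simp
    · intro π hπ π' hπ' hne
      rw [Finset.disjoint_left]
      intro x hx hx'
      apply hne
      rcases (hmem π).1 hπ with ⟨-, ρ, hρ, rfl⟩ | ⟨y, hy, rfl⟩ <;>
        rcases (hmem π').1 hπ' with ⟨-, ρ', hρ', rfl⟩ | ⟨y', hy', rfl⟩
      · rw [h.eq_of_mem hρ hρ' ((hcut ρ hρ x).1 hx).1 ((hcut ρ' hρ' x).1 hx').1]
      · rw [Finset.mem_singleton.1 hx'] at hx
        exact absurd (h.cell_subset ρ hρ ((hcut ρ hρ _).1 hx).1) (Finset.mem_sdiff.1 hy').2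
      · rw [Finset.mem_singleton.1 hx] at hx'
        exact absurd (h.cell_subset ρ' hρ' ((hcut ρ' hρ' _).1 hx').1) (Finset.mem_sdiff.1 hy).2
      · rw [← Finset.mem_singleton.1 hx, ← Finset.mem_singleton.1 hx']
  · intro π hπ x hx hxo
    rcases (hmem π).1 hπ with ⟨-, ρ, hρ, rfl⟩ | ⟨y, -, rfl⟩
    · exact absurd (h.cell_subset ρ hρ ((hcut ρ hρ x).1 hx).1) hxo
    · rw [Finset.mem_singleton.1 hx]

/-- The second state `x'` keeps the remainder of the cell nonempty, so one cell is replaced by two.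
-/
theorem IsIsolated.split {old s : Finset X} {C : Finset (Finset X)} (h : IsIsolated old s C)
    {x x' : X} (hx : x ∈ s) (hx' : x' ∈ cell C x) (hne : x' ≠ x) :
    IsIsolated old s ((C \ {cell C x}) ∪ {cell C x \ {x}} ∪ {{x}}) ∧
      C.card < ((C \ {cell C x}) ∪ {cell C x \ {x}} ∪ {{x}}).card := by
  have hxc := h.mem_cell_self hx
  have hmem : ∀ π, π ∈ (C \ {cell C x}) ∪ {cell C x \ {x}} ∪ {{x}} ↔
      (π ∈ C ∧ π ≠ cell C x) ∨ π = cell C x \ {x} ∨ π = {x} := by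
    intro π
    simp only [Finset.mem_union, Finset.mem_sdiff, Finset.mem_singleton, or_assoc, ne_eq]
  have hother : ∀ π ∈ C, π ≠ cell C x → ∀ y ∈ π, y ∉ cell C x := fun π hπ hn y hy hy' =>
    hn (h.eq_of_mem hπ (h.cell_mem hx) hy hy')
  refine ⟨⟨⟨?_, ?_, ?_, ?_⟩, ?_⟩, ?_⟩
  · intro π hπ
    rcases (hmem π).1 hπ with ⟨hπ, -⟩ | rfl | rfl
    · exact h.cell_subset π hπ
    · exact Finset.sdiff_subset.trans (h.cell_sub x)
    · simpa using hx
  · intro y hy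
    by_cases hyx : y = x
    · exact ⟨{x}, (hmem _).2 (Or.inr (Or.inr rfl)), by simp [hyx]⟩
    by_cases hyc : y ∈ cell C x
    · exact ⟨_, (hmem _).2 (Or.inr (Or.inl rfl)), by simp [hyx, hyc]⟩
    · refine ⟨cell C y, (hmem _).2 (Or.inl ⟨h.cell_mem hy, fun e => hyc ?_⟩), h.mem_cell_self hy⟩
      exact e ▸ h.mem_cell_self hy
  · intro π hπ
    rcases (hmem π).1 hπ with ⟨hπ, -⟩ | rfl | rfl
    · exact h.nonempty π hπ
    · exact ⟨x', by simp [hx', hne]⟩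
    · simp
  · intro π hπ ρ hρ hn
    rw [Finset.disjoint_left]
    intro y hy hy'
    apply hn
    rcases (hmem π).1 hπ with ⟨hπ, hπn⟩ | rfl | rfl <;>
      rcases (hmem ρ).1 hρ with ⟨hρ, hρn⟩ | rfl | rfl
    · exact h.eq_of_mem hπ hρ hy hy'
    · exact absurd (Finset.mem_sdiff.1 hy').1 (hother π hπ hπn y hy)
    · exact absurd (Finset.mem_singleton.1 hy' ▸ hxc) (hother π hπ hπn y hy)
    · exact absurd (Finset.mem_sdiff.1 hy).1 (hother ρ hρ hρn y hy')
    · rfl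
    · exact absurd hy' (Finset.mem_sdiff.1 hy).2
    · exact absurd (Finset.mem_singleton.1 hy ▸ hxc) (hother ρ hρ hρn y hy')
    · exact absurd hy (Finset.mem_sdiff.1 hy').2
    · rfl
  · intro π hπ y hy hyo
    rcases (hmem π).1 hπ with ⟨hπ, -⟩ | rfl | rfl
    · exact h.singleton π hπ y hy hyo
    · have hyc := Finset.mem_sdiff.1 hy
      have := h.singleton _ (h.cell_mem hx) y hyc.1 hyo
      rw [this, Finset.mem_singleton] at hxc
      exact absurd (Finset.mem_singleton.2 hxc.symm) hyc.2
    · rw [Finset.mem_singleton.1 hy]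
  · have h₁ : {x} ∉ C := fun hc => hne (by
      rw [h.cell_eq hc (Finset.mem_singleton_self x)] at hx'
      exact Finset.mem_singleton.1 hx')
    have h₂ : cell C x \ {x} ∉ C \ {cell C x} := fun hc => by
      obtain ⟨hc, hcn⟩ := Finset.mem_sdiff.1 hc
      exact hother _ hc (by simpa using hcn) x' (by simp [hx', hne]) hx'
    have h₃ : {x} ∉ (C \ {cell C x}) ∪ {cell C x \ {x}} := fun hc => by
      rcases Finset.mem_union.1 hc with hc | hc
      · exact h₁ (Finset.mem_sdiff.1 hc).1
      · have := Finset.mem_singleton.1 hc ▸ Finset.mem_singleton_self x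
        exact absurd (Finset.mem_singleton_self x) (Finset.mem_sdiff.1 this).2
    rw [Finset.card_union_of_disjoint (Finset.disjoint_singleton_right.2 h₃),
      Finset.card_union_of_disjoint (Finset.disjoint_singleton_right.2 h₂),
      Finset.card_sdiff_of_subset (Finset.singleton_subset_iff.2 (h.cell_mem hx))]
    simp only [Finset.card_singleton]
    omega

variable {G : Automaton Q Ev} {S : Automaton X Ev} {Sc : Finset Ev} {old : Finset X}
  {C : Finset (Finset X)}

theorem Conflict.exists_ne {x : X} (h : Conflict G S Sc C x) : ∃ x' ∈ cell C x, x' ≠ x := by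
  obtain ⟨x', hx', h⟩ := h
  refine ⟨x', hx', ?_⟩
  rintro rfl
  rcases h with h | ⟨σ, y, y', hy, hy', hn⟩
  · exact h (consistent_self _ _ _ _)
  · rw [hy] at hy'
    cases hy'
    exact hn rfl

/-- The rounds never examine states outside `old`; these are alone in their cells and so cannot be
in conflict. -/
theorem IsIsolated.isControlCongruence (hS : S.Valid) (h : IsIsolated old S.states C)
    (hc : ∀ x ∈ S.states ∩ old, ¬ Conflict G S Sc C x) : IsControlCongruence G S Sc C := by
  have hself : ∀ x, ∀ x' ∈ cell C x, x ∉ old → x' = x := by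
    intro x x' hx' hxo
    have hx := h.left_mem hx'
    rw [h.singleton _ (h.cell_mem hx) x (h.mem_cell_self hx) hxo] at hx'
    exact Finset.mem_singleton.1 hx'
  refine h.toIsPartition.isControlCongruence hS ?_ ?_
  · intro x x' hx'
    by_cases hxo : x ∈ old
    · by_contra hn
      exact hc x (Finset.mem_inter.2 ⟨h.left_mem hx', hxo⟩) ⟨x', hx', Or.inl hn⟩
    · rw [hself x x' hx' hxo]
      exact consistent_self _ _ _ _
  · intro x x' hx' σ y y' hy hy'
    by_cases hxo : x ∈ old
    · by_contra hn
      exact hc x (Finset.mem_inter.2 ⟨h.left_mem hx', hxo⟩)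
        ⟨x', hx', Or.inr ⟨σ, y, y', hy, hy', hn⟩⟩
    · rw [hself x x' hx' hxo, hy] at hy'
      cases hy'
      rfl

theorem isolateFold_spec : ∀ (l : List X) (acc : Finset (Finset X) × Bool),
    (∀ x ∈ l, x ∈ S.states) → IsIsolated old S.states acc.1 →
    Spec (fun _ => l.foldlM (fun (acc : Finset (Finset X) × Bool) x => (do
      charge (1 + (cell acc.1 x).card * (1 + S.events.card))
      if Conflict G S Sc acc.1 x then do
        charge 1
        pure ((acc.1 \ {cell acc.1 x}) ∪ {cell acc.1 x \ {x}} ∪ {{x}}, true)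
      else
        pure acc : Counted (Finset (Finset X) × Bool))) acc) fun r k =>
      IsIsolated old S.states r.1 ∧ acc.1.card ≤ r.1.card ∧
      (r.2 = true → acc.2 = true ∨ acc.1.card < r.1.card) ∧
      (r.2 = false → acc.2 = false ∧ r.1 = acc.1 ∧ ∀ x ∈ l, ¬ Conflict G S Sc acc.1 x) ∧
      k ≤ l.length * (2 + S.states.card * (1 + S.events.card))
  | [], acc, _, hacc => by
    simp only [List.foldlM_nil]
    exact Spec.pure ⟨hacc, le_rfl, Or.inl, fun h => ⟨h, rfl, by simp⟩, by simp⟩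
  | x :: l, acc, hl, hacc => by
    have hx := hl x (by simp)
    have hcost := Nat.mul_le_mul_right (1 + S.events.card)
      (Finset.card_le_card (hacc.cell_sub x))
    have ih := fun acc' => isolateFold_spec l acc' fun y hy => hl y (by simp [hy])
    simp only [List.foldlM_cons, bind_assoc]
    refine Spec.charge ?_
    by_cases h : Conflict G S Sc acc.1 x
    · simp only [if_pos h, bind_assoc, pure_bind]
      refine Spec.charge ?_
      obtain ⟨x', hx', hne⟩ := h.exists_ne
      obtain ⟨h₁, h₂⟩ := hacc.split hx hx' hne
      refine (ih (_, true) h₁).mono fun r k hr => ?_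
      obtain ⟨hr₁, hr₂, -, hr₄, hr₅⟩ := hr
      refine ⟨hr₁, (h₂.trans_le hr₂).le, fun _ => Or.inr (h₂.trans_le hr₂),
        fun e => absurd (hr₄ e).1 (by simp), ?_⟩
      rw [List.length_cons, add_mul, one_mul]
      omega
    · simp only [if_neg h, pure_bind]
      refine (ih acc hacc).mono fun r k hr => ?_
      obtain ⟨hr₁, hr₂, hr₃, hr₄, hr₅⟩ := hr
      refine ⟨hr₁, hr₂, hr₃, fun e => ⟨(hr₄ e).1, (hr₄ e).2.1, ?_⟩, ?_⟩
      · intro y hy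
        rcases List.mem_cons.1 hy with rfl | hy
        · exact h
        · exact (hr₄ e).2.2 y hy
      · rw [List.length_cons, add_mul, one_mul]
        omega

theorem isolateLoop_spec (hS : S.Valid) (ord : LoopOrder X Ev) :
    ∀ (d : ℕ) (C : Finset (Finset X)), IsIsolated old S.states C → S.states.card ≤ C.card + d →
      Spec (fun f => isolateLoop ord G S Sc old f C) fun r k => IsControlCongruence G S Sc r ∧
        k ≤ (d + 1) * (1 + S.states.card * (2 + S.states.card * (1 + S.events.card))) := by
  intro d
  induction d with
  | zero => ?_
  | succ d ih => ?_
  -- A round without change ends the loop in both cases. They differ only after an isolation, which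
  -- `d = 0` excludes: there are already as many cells as states.
  all_goals
    intro C hC hd
    refine Spec.of_succ ?_
    simp only [isolateLoop, isolateRound]
    refine Spec.charge (Spec.bind (isolateFold_spec (G := G) (S := S) (Sc := Sc) (old := old)
      (ord.states (S.states ∩ old)) (C, false)
      (fun x hx => (Finset.mem_inter.1 ((ord.mem_states _ _).1 hx)).1) hC) ?_)
    rintro r k ⟨h₁, h₂, h₃, h₄, h₅⟩
    have hlen : (ord.states (S.states ∩ old)).length ≤ S.states.card := by
      rw [← List.toFinset_card_of_nodup (ord.states_nodup _)]
      refine Finset.card_le_card fun x hx => ?_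
      rw [List.mem_toFinset, ord.mem_states] at hx
      exact (Finset.mem_inter.1 hx).1
    have hk := h₅.trans (Nat.mul_le_mul_right _ hlen)
    have hle := h₁.toIsPartition.card_le
    by_cases h : r.2 = true
    swap
    · simp only [if_neg h]
      obtain ⟨-, h₆, h₇⟩ := h₄ (by simpa using h)
      refine Spec.pure ⟨h₁.isControlCongruence hS fun x hx => ?_, ?_⟩
      · rw [h₆]
        exact h₇ x ((ord.mem_states _ _).2 hx)
      · rw [add_mul, one_mul]
        omega
  · rcases h₃ h with h₃ | h₃
    · simp at h₃
    · simp only at h₃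
      omega
  · simp only [if_pos h]
    rcases h₃ h with h₃ | h₃
    · simp at h₃
    simp only at h₃
    refine (ih r.1 h₁ (by omega)).mono fun r' k' hr' => ⟨hr'.1, ?_⟩
    have := hr'.2
    rw [add_mul (d + 1), one_mul]
    omega

theorem isolate_spec (hS : S.Valid) (ord : LoopOrder X Ev) (hC : IsPartition old C) :
    Spec (fun f => isolate ord G S Sc old f C) fun r k => IsControlCongruence G S Sc r ∧
      k ≤ S.states.card + (S.states.card + 1) *
        (1 + S.states.card * (2 + S.states.card * (1 + S.events.card))) := by
  refine Spec.charge ((isolateLoop_spec hS ord S.states.card _ (isIsolated_isolateInit hC _)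
    (by omega)).mono fun r k hr => ⟨hr.1, ?_⟩)
  have := hr.2
  omega

theorem singletonCover_isControlCongruence (hS : S.Valid) :
    IsControlCongruence G S Sc (singletonCover S) :=
  (isIsolated_singletonCover ∅ S.states).isControlCongruence hS (by simp)

end Isolate
/-! ### Control equivalence -/

section Equivalence

variable {Q X Ev : Type*}

theorem Automaton.run_append_singleton (A : Automaton X Ev) (s : List Ev) (σ : Ev) :
    A.run (s ++ [σ]) = (A.run s).bind fun x => A.trans x σ := by
  simp only [Automaton.run, List.foldlM_append, List.foldlM_cons, List.foldlM_nil]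
  simp

theorem Automaton.mem_lang_of_append {A : Automaton X Ev} {s : List Ev} {σ : Ev}
    (h : s ++ [σ] ∈ A.lang) : s ∈ A.lang := by
  obtain ⟨x, hx⟩ := h
  rw [A.run_append_singleton] at hx
  obtain ⟨y, hy, -⟩ := Option.bind_eq_some_iff.1 hx
  exact ⟨y, hy⟩

theorem Automaton.mem_lang_of_marked {A : Automaton X Ev} {s : List Ev} (h : s ∈ A.markedLang) :
    s ∈ A.lang := by
  obtain ⟨x, -, hx⟩ := h
  exact ⟨x, hx⟩

variable {G : Automaton Q Ev} {S : Automaton X Ev} {Sc : Finset Ev} {C : Finset (Finset X)}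

theorem localSupervisor_run (hS : S.Valid) (hC : IsControlCongruence G S Sc C) (s : List Ev) :
    ∀ x, S.run s = some x → (localSupervisor S C).run s = some (cell C x) := by
  induction s using List.reverseRecOn with
  | nil =>
    intro x hx
    obtain rfl : S.init = x := by simpa [Automaton.run] using hx
    rfl
  | append_singleton s σ ih =>
    intro x hx
    rw [S.run_append_singleton] at hx
    obtain ⟨y, hy, hyx⟩ := Option.bind_eq_some_iff.1 hx
    rw [Automaton.run_append_singleton, ih y hy, Option.bind_some,
      localSupervisor_trans hS hC]
    have hp := hC.isPartition
    obtain ⟨hys, -, hxs⟩ := hS.trans_mem _ _ _ hyx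
    exact ⟨hp.cell_mem hys, hp.cell_mem hxs, y, hp.mem_cell_self hys, x, hp.mem_cell_self hxs,
      hyx⟩

/-- An event that the local supervisor and the plant allow and that belongs to the agent is
allowed by the supervisor. -/
theorem append_mem_lang_of_local (hS : S.Valid) (hC : IsControlCongruence G S Sc C) {s : List Ev}
    {σ : Ev} (hσ : σ ∈ Sc) (hs : s ∈ S.lang) (hG : s ++ [σ] ∈ G.lang)
    (hloc : s ++ [σ] ∈ (localSupervisor S C).lang) : s ++ [σ] ∈ S.lang := by
  obtain ⟨x, hx⟩ := hs
  obtain ⟨ρ, hρ⟩ := hloc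
  rw [Automaton.run_append_singleton, localSupervisor_run hS hC s x hx, Option.bind_some,
    localSupervisor_trans hS hC] at hρ
  obtain ⟨-, -, x', hx', y, -, hy⟩ := hρ
  rw [Automaton.lang, Set.mem_ofPred_eq, S.run_append_singleton, hx, Option.bind_some]
  by_contra hn
  have hE : σ ∈ S.enabled x' := Finset.mem_filter.2 ⟨(hS.trans_mem _ _ _ hy).2.1, y, hy⟩
  have hD : σ ∈ disabled G S Sc x := by
    refine Finset.mem_filter.2 ⟨hσ, ?_, s, hx, hG⟩
    rcases h : S.trans x σ with _ | z
    · rfl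
    · exact absurd ⟨z, h⟩ hn
  exact Finset.disjoint_left.1 (hC.consistent_of_mem hx').2.1 hE hD

/-- The cell reached contains a marked `x'`. Both `x` and `x'` are plant-marked, `x` through `s`
itself and `x'` by `hmark`, so consistency transfers the marking to `x`. -/
theorem mem_markedLang_of_local (hS : S.Valid) (hC : IsControlCongruence G S Sc C)
    (hmark : ∀ x ∈ S.marked, PlantMarked G S x) {s : List Ev} (hs : s ∈ S.lang)
    (hG : s ∈ G.markedLang) (hloc : s ∈ (localSupervisor S C).markedLang) :
    s ∈ S.markedLang := by
  obtain ⟨x, hx⟩ := hs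
  obtain ⟨ρ, hρ, hrun⟩ := hloc
  rw [localSupervisor_run hS hC s x hx] at hrun
  cases hrun
  obtain ⟨x', hx', he⟩ := Finset.mem_image.1 hρ
  have hmem : x' ∈ cell C x := by
    rw [← he]
    exact hC.isPartition.mem_cell_self (hS.marked_subset hx')
  have hT : PlantMarked G S x := ⟨s, hx, hG⟩
  exact ⟨x, ((hC.consistent_of_mem hmem).2.2 (iff_of_true hT (hmark x' hx'))).2 hx', hx⟩

/-- Local supervisors of control congruences for all agents are control equivalent to the
monolithic supervisor. -/
theorem controlEquivalent_localSupervisor {n : ℕ} (V : ControlledSystem Q X Ev n)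
    (hV : V.Valid) (hs : V.IsSupervised) (hn : 0 < n) (D : Fin n → Finset (Finset X))
    (hD : ∀ k, IsControlCongruence V.plant V.sup (V.ctrl k) (D k)) :
    ControlEquivalent V.plant V.sup fun k => localSupervisor V.sup (D k) := by
  have hS := hV.sup_valid
  have key : ∀ s : List Ev, s ∈ V.plant.lang → (∀ k, s ∈ (localSupervisor V.sup (D k)).lang) →
      s ∈ V.sup.lang := by
    intro s
    induction s using List.reverseRecOn with
    | nil => exact fun _ _ => ⟨_, rfl⟩
    | append_singleton s σ ih =>
      intro hG hloc
      have hs' := ih (Automaton.mem_lang_of_append hG)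
        fun k => Automaton.mem_lang_of_append (hloc k)
      by_cases h : ∃ k, σ ∈ V.ctrl k
      · obtain ⟨k, hk⟩ := h
        exact append_mem_lang_of_local hS (hD k) hk hs' hG (hloc k)
      · exact hs.controllable s σ hs' hG fun k hk => h ⟨k, hk⟩
  constructor
  · ext s
    simp only [Set.mem_inter_iff, Set.mem_iInter]
    constructor
    · exact fun h => ⟨key s h.1 h.2, h.1⟩
    · rintro ⟨⟨x, hx⟩, hG⟩
      exact ⟨hG, fun k => ⟨_, localSupervisor_run hS (hD k) s x hx⟩⟩
  · ext s
    simp only [Set.mem_inter_iff, Set.mem_iInter]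
    constructor
    · rintro ⟨hG, hloc⟩
      -- A single agent decides the marking; this is where the existence of an agent is needed.
      refine ⟨mem_markedLang_of_local hS (hD ⟨0, hn⟩) hs.marking (key s ?_ fun k => ?_) hG
        (hloc _), hG⟩
      · exact Automaton.mem_lang_of_marked hG
      · exact Automaton.mem_lang_of_marked (hloc k)
    · rintro ⟨⟨x, hxm, hx⟩, hG⟩
      exact ⟨hG, fun k => ⟨cell (D k) x, Finset.mem_image_of_mem _ hxm,
        localSupervisor_run hS (hD k) s x hx⟩⟩

end Equivalence

/-! ### `TSL` -/

theorem tsl_spec {Q X Ev : Type} {n n' N : ℕ} (ord : LoopOrder X Ev) (num : Fin N → X)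
    {old : Finset X} {C : Fin n → Finset (Finset X)} (hC : ∀ j, IsPartition old (C j))
    {V : ControlledSystem Q X Ev n'} (hV : V.Valid) (hnum : ∀ i, num i ∈ V.sup.states)
    (M : Fin n' → Option (Fin n)) :
    Spec (fun f => tsl ord num old C V M f) fun r k =>
      (∀ k, IsControlCongruence V.plant V.sup (V.ctrl k) (r k).2 ∧
        (r k).1 = localSupervisor V.sup (r k).2) ∧
      k ≤ n' * (1 + (V.sup.states.card + (V.sup.states.card + 1) *
        (1 + V.sup.states.card * (2 + V.sup.states.card * (1 + V.sup.events.card))) +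
        (N * (1 + N * (3 + ((4 * V.sup.events.card + 2) * V.sup.states.card ^ 2 +
          V.sup.events.card) + V.sup.states.card ^ 2)) +
        V.sup.states.card * (1 + V.sup.events.card)))) := by
  have hS := hV.sup_valid
  refine Spec.forEach n' (P := fun k (r : Automaton (Finset X) Ev × Finset (Finset X)) =>
    IsControlCongruence V.plant V.sup (V.ctrl k) r.2 ∧
    r.1 = localSupervisor V.sup r.2) fun k => ?_
  have build := fun Cinit (h : IsControlCongruence V.plant V.sup (V.ctrl k) Cinit) =>
    Spec.bind (g := fun _ Ck => (do
        charge (V.sup.states.card * (1 + V.sup.events.card))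
        pure (localSupervisor V.sup Ck, Ck) :
          Counted (Automaton (Finset X) Ev × Finset (Finset X))))
      (P' := fun r c => (IsControlCongruence V.plant V.sup (V.ctrl k) r.2 ∧
        r.1 = localSupervisor V.sup r.2) ∧
        c ≤ N * (1 + N * (3 + ((4 * V.sup.events.card + 2) * V.sup.states.card ^ 2 +
          V.sup.events.card) + V.sup.states.card ^ 2)) +
          V.sup.states.card * (1 + V.sup.events.card))
      (localize_spec hS h ord num hnum)
      fun Ck c hCk => Spec.charge (Spec.pure ⟨⟨hCk.1, rfl⟩, by have := hCk.2; omega⟩)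
  refine Spec.charge ?_
  rcases M k with _ | j
  · refine Spec.charge (Spec.bind (P := fun r c => r = singletonCover V.sup ∧ c = 0)
      (Spec.pure ⟨rfl, rfl⟩) ?_)
    rintro _ _ ⟨rfl, rfl⟩
    refine (build _ (singletonCover_isControlCongruence hS)).mono fun r c hr => ⟨hr.1, ?_⟩
    have := hr.2
    omega
  · refine Spec.bind (isolate_spec hS ord (hC j)) fun Cinit c hc => ?_
    refine (build _ hc.1).mono fun r c' hr => ⟨hr.1, ?_⟩
    have := hr.2
    have := hc.2
    omega

/-- Every monomial on the left is at most m x⁴, and the coefficients add up to 26. -/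
theorem cost_le {x m : ℕ} (hx : 1 ≤ x) (hm : 1 ≤ m) :
    1 + (x + (x + 1) * (1 + x * (2 + x * (1 + m))) +
      (x * (1 + x * (3 + ((4 * m + 2) * x ^ 2 + m) + x ^ 2)) + x * (1 + m))) ≤
      30 * (m * x ^ 4) := by
  have h₁ : ∀ a ≤ 4, x ^ a * m ≤ x ^ 4 * m := fun a ha =>
    Nat.mul_le_mul_right m (Nat.pow_le_pow_right hx ha)
  have h₂ : ∀ a ≤ 4, x ^ a ≤ x ^ 4 * m := fun a ha =>
    (Nat.le_mul_of_pos_right _ hm).trans (h₁ a ha)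
  have := h₁ 1 (by omega)
  have := h₁ 2 (by omega)
  have := h₁ 3 (by omega)
  have := h₂ 0 (by omega)
  have := h₂ 1 (by omega)
  have := h₂ 2 (by omega)
  have := h₂ 3 (by omega)
  have := h₂ 4 (by omega)
  ring_nf at *
  omega

end SupLoc

theorem theorem2 :
    ∃ c : ℕ,
      ∀ {Q Q' X Ev : Type} {n n' : ℕ}
        -- the base system and its control congruences
        (B : SupLoc.ControlledSystem Q X Ev n) (_ : B.Valid)
        (C : Fin n → Finset (Finset X))
        (_ : ∀ k, SupLoc.IsControlCongruence B.plant B.sup (B.ctrl k) (C k))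
        -- the variant system
        (V : SupLoc.ControlledSystem Q' X Ev n') (_ : V.Valid) (_ : V.IsSupervised) (_ : 0 < n')
        (M : Fin n' → Option (Fin n))
        -- the numbering of the variant states and the order of the loops over sets
        (num : Fin V.sup.states.card ≃ V.sup.states) (ord : SupLoc.LoopOrder X Ev),
        ∃ (out : Fin n' → SupLoc.Automaton (Finset X) Ev × Finset (Finset X)) (cost : ℕ),
          SupLoc.HaltsWith (SupLoc.tsl ord (fun i => (num i : X)) B.sup.states C V M) out cost ∧
          (V.sup.events.Nonempty →
            cost ≤ c * (n' * V.sup.events.card * V.sup.states.card ^ 4)) ∧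
          (∀ k, SupLoc.IsControlCongruence V.plant V.sup (V.ctrl k) (out k).2 ∧
            (out k).1 = SupLoc.localSupervisor V.sup (out k).2) ∧
          SupLoc.ControlEquivalent V.plant V.sup (fun k => (out k).1) := by
  refine ⟨30, ?_⟩
  intro Q Q' X Ev n n' B _ C hC V hV hsup hn M num ord
  obtain ⟨out, cost, hrun, hout, hcost⟩ := SupLoc.tsl_spec ord (fun i => (num i : X))
    (fun j => (hC j).isPartition) hV (fun i => (num i).2) M 0
  rw [Nat.zero_add] at hrun
  refine ⟨out, cost, hrun, fun hne => hcost.trans ?_, hout, ?_⟩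
  · have hx : 1 ≤ V.sup.states.card := Finset.card_pos.2 ⟨_, hV.sup_valid.init_mem⟩
    calc _ ≤ n' * (30 * (V.sup.events.card * V.sup.states.card ^ 4)) :=
          Nat.mul_le_mul_left n' (SupLoc.cost_le hx (Finset.card_pos.2 hne))
      _ = _ := by ring
  · rw [funext fun k => (hout k).2]
    exact SupLoc.controlEquivalent_localSupervisor V hV hsup hn _ fun k => (hout k).1
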